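/- Let $n\ge 0$ and let $\alpha=(\alpha_1,\dots,\alpha_\ell)$ be a composition of $n$. Let $H_n(0)$ be the $0$-Hecke algebra over $\mathbb C$, generated by $\pi_1,\dots,\pi_{n-1}$ with the relations $\pi_i^2=\pi_i$, $\pi_i\pi_{i+1}\pi_i=\pi_{i+1}\pi_i\pi_{i+1}$, and $\pi_i\pi_j=\pi_j\pi_i$ for $|i-j|\ge 2$. A standard immaculate tableau (SIT) of shape $\alpha$ is a bijective filling with $1,\dots,n$ of the composition diagram of $\alpha$ (left-justified, with $\alpha_i$ boxes in the $i$th row from the top) whose rows increase from left to right and whose first column increases from top to bottom. $\mathcal V_\alpha$ is the $H_n(0)$-module with $\mathbb C$-basis the SITs $\mathcal T$ of shape $\alpha$ and with action: $\pi_i\cdot\mathcal T=\mathcal T$ if $i$ is not strictly above $i+1$ in $\mathcal T$; otherwise $\pi_i\cdot\mathcal T=0$ if $i$ and $i+1$ are both in the first column, and $\pi_i\cdot\mathcal T=s_i\cdot\mathcal T$ (swap $i$ and $i+1$) if not. A generalized composition of $n$ is a formal sum $\boldsymbol\beta=\beta^{(1)}\oplus\cdots\oplus\beta^{(p)}$ of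 nonempty compositions of total size $n$. The ribbon diagram of a composition $\beta$ is the connected skew diagram without $2\times2$ squares whose $i$th column from the left has $\beta_i$ boxes. The diagram of $\boldsymbol\beta$ has the ribbon diagrams of $\beta^{(1)},\dots,\beta^{(p)}$ as connected components, each one strictly to the north-east of the preceding one. A standard ribbon tableau (SRT) of shape $\boldsymbol\beta$ is a bijective filling of this diagram with $1,\dots,n$ whose rows increase from left to right and whose columns increase from top to bottom. $\mathbf P_{\boldsymbol\beta}$ is the $H_n(0)$-module with $\mathbb C$-basis the SRTs $T$ of shape $\boldsymbol\beta$ and with action: $\pi_i\cdot T=T$ if $i$ is strictly above $i+1$ in $T$, $\pi_i\cdot T=0$ if $i$ and $i+1$ are in the same row, and $\pi_i\cdot T=s_i\cdot T$ if $i$ is strictly below $i+1$. Let $k_1<\dots<k_m$ be the indices $i$ with $\alpha_i>1$. Put $$\tilde\alpha=(\alpha_{k_1}-1)\oplus\cdots\oplus(\alpha_{k_{m-1}}-1)\oplus(\alpha_{k_m},1^{\ell-1}),$$ with $\tilde\alpha=(1^n)$ if $m=0$ (the empty formal sum if $n=0$). In the composition diagram of $\alpha$ let $S_0$ be the first column and,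 for $1\le j\le m$, let $S_j$ be the $k_j$th row without its leftmost box. In the diagram of $\tilde\alpha$ let $S_0$ be the topmost row and, for $1\le j\le m$, let $S_j$ be the $j$th column from the left without its box in the topmost row, if it has one. **Theorem.** For every SIT $\mathcal T$ of shape $\alpha$ there is exactly one SRT $T^{\mathcal T}$ of shape $\tilde\alpha$ that has, for every $0\le j\le m$, the same set of entries in $S_j$ as $\mathcal T$. The linear map $\mathcal V_\alpha\to\mathbf P_{\tilde\alpha}$, $\mathcal T\mapsto T^{\mathcal T}$, is an injective $H_n(0)$-module homomorphism, and it is an injective hull of $\mathcal V_\alpha$: the $H_n(0)$-module $\mathbf P_{\tilde\alpha}$ is injective, and every nonzero submodule of $\mathbf P_{\tilde\alpha}$ meets the image of $\mathcal V_\alpha$ nontrivially. Moreover, the socle of $\mathbf P_{\tilde\alpha}$ (the sum of its simple submodules) is contained in this image. -/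

import Mathlib

/-! ### Generalized compositions -/

/-- A generalized composition of `n`: a finite formal sum of nonempty compositions, given as the
list of its summands, with total size `n`. -/
@[ext] structure GenComposition (n : ℕ) where
  summands : List (List ℕ)
  summands_ne_nil : ∀ c ∈ summands, c ≠ []
  parts_pos : ∀ c ∈ summands, ∀ a ∈ c, 0 < a
  sum_eq : summands.flatten.sum = n

/-- The summands of the generalized composition attached to a composition of length `l`, as a
function of the list of the parts of that composition which are `> 1`:
`(a₁, …, a_m) ↦ (a₁ - 1) ⊕ ⋯ ⊕ (a_{m-1} - 1) ⊕ (a_m, 1, …, 1)` with `l - 1` ones at the end.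
If there are no parts `> 1`, the result is the single summand `(1, …, 1)` with `l` ones
(and the empty formal sum if moreover `l = 0`). -/
def tildeSummands (l : ℕ) : List ℕ → List (List ℕ)
  | [] => if l = 0 then [] else [List.replicate l 1]
  | [a] => [a :: List.replicate (l - 1) 1]
  | a :: b :: t => [a - 1] :: tildeSummands l (b :: t)

theorem tildeSummands_ne_nil (l : ℕ) (L : List ℕ) : ∀ c ∈ tildeSummands l L, c ≠ [] := by
  fun_induction tildeSummands l L <;> simp_all

theorem tildeSummands_pos (l : ℕ) (L : List ℕ) (hL : ∀ a ∈ L, 1 < a) :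
    ∀ c ∈ tildeSummands l L, ∀ a ∈ c, 0 < a := by
  fun_induction tildeSummands l L with
  | case1 => simp
  | case2 => simp
  | case3 a =>
    intro c hc x hx
    simp only [List.mem_singleton] at hc
    subst hc
    simp only [List.mem_cons, List.mem_replicate] at hx
    have := hL a (by simp)
    omega
  | case4 a b t ih =>
    intro c hc x hx
    rcases List.mem_cons.1 hc with rfl | hc
    · have := hL a (by simp)
      simp only [List.mem_singleton] at hx
      omega
    · exact ih (fun a ha => hL a (List.mem_cons_of_mem _ ha)) c hc x hx

theorem tildeSummands_sum (l : ℕ) (L : List ℕ) (hL : ∀ a ∈ L, 1 < a) (hl : L ≠ [] → 0 < l) :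
    (tildeSummands l L).flatten.sum + L.length = L.sum + l := by
  fun_induction tildeSummands l L with
  | case1 h => simp [h]
  | case2 h => simp
  | case3 a =>
    have := hl (by simp)
    simp
    omega
  | case4 a b t ih =>
    have h1 := ih (fun a ha => hL a (List.mem_cons_of_mem _ ha)) (fun _ => hl (by simp))
    have h2 := hL a (by simp)
    simp at h1 ⊢
    omega

theorem sum_eq_filter (L : List ℕ) (hL : ∀ a ∈ L, 0 < a) :
    (L.filter (fun a => 1 < a)).sum + L.length = L.sum + (L.filter (fun a => 1 < a)).length := by
  induction L with
  | nil => simp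
  | cons a t ih =>
    have h1 := ih (fun a ha => hL a (List.mem_cons_of_mem _ ha))
    have h2 := hL a (by simp)
    rw [List.filter_cons]
    split_ifs with h
    · simp; omega
    · simp at h ⊢; omega

/-- The generalized composition
`(α_{k₁} - 1) ⊕ ⋯ ⊕ (α_{k_{m-1}} - 1) ⊕ (α_{k_m}, 1^{ℓ(α) - 1})`, where `k₁ < ⋯ < k_m` are the
indices of the parts of `α` that are larger than `1` (and `(1^n)` if there are none). -/
def Composition.tilde {n : ℕ} (α : Composition n) : GenComposition n where
  summands := tildeSummands α.length (α.blocks.filter (fun a => 1 < a))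
  summands_ne_nil := tildeSummands_ne_nil _ _
  parts_pos := tildeSummands_pos _ _ (by simp)
  sum_eq := by
    have h1 := tildeSummands_sum α.length (α.blocks.filter (fun a => 1 < a)) (by simp) (by
      intro h
      by_contra h0
      have : α.blocks = [] := List.length_eq_zero_iff.1 (by
        have := α.blocks_length
        omega)
      simp [this] at h)
    have h2 := sum_eq_filter α.blocks (fun a ha => α.blocks_pos ha)
    rw [α.blocks_length, α.blocks_sum] at h2
    omega

/-! ### Diagrams -/

/-- The composition diagram of `α`. The cell `(r, c)` lies in row `r` (counted from the top) and in
column `c` (counted from the left), both starting from `0`. -/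
def compCells {n : ℕ} (α : Composition n) : Finset (ℕ × ℕ) :=
  (Finset.range α.length ×ˢ Finset.range n).filter (fun b => b.2 < α.blocks.getD b.1 0)

/-- The ribbon diagram of a composition: its columns have, from the left, the parts as lengths, and
the lowest cell of each column is in the row of the topmost cell of the preceding column. The cell
`(h, c)` lies in the row at height `h` (counted from the BOTTOM) and in column `c` (counted from
the left), both starting from `0`. -/
def ribbonCells : List ℕ → Finset (ℕ × ℕ)
  | [] => ∅
  | a :: c =>
    (Finset.range a).image (fun h => (h, 0)) ∪
      (ribbonCells c).image (fun b => (b.1 + (a - 1), b.2 + 1))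

/-- The number of rows of the ribbon diagram of a nonempty composition. -/
def ribbonHeight (c : List ℕ) : ℕ := (c.map (fun a => a - 1)).sum + 1

/-- The generalized ribbon diagram: each connected component is placed strictly to the north-east
of the preceding ones. Coordinates are as in `ribbonCells`. -/
def genRibbonCells : List (List ℕ) → Finset (ℕ × ℕ)
  | [] => ∅
  | c :: l =>
    ribbonCells c ∪ (genRibbonCells l).image (fun b => (b.1 + ribbonHeight c, b.2 + c.length))

/-! ### Tableaux

The entries `1, …, n` of a tableau are represented by the elements `0, …, n - 1` of `Fin n`, and
the generators `π_1, …, π_{n-1}` of the 0-Hecke algebra are indexed by `Fin (n - 1)` accordingly: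
the index `i` belongs to the two consecutive entries `lo i = i` and `hi i = i + 1`. -/

/-- The smaller one of the two entries exchanged by the `i`-th simple transposition. -/
def lo {n : ℕ} (i : Fin (n - 1)) : Fin n := ⟨i.1, by omega⟩

/-- The larger one of the two entries exchanged by the `i`-th simple transposition. -/
def hi {n : ℕ} (i : Fin (n - 1)) : Fin n := ⟨i.1 + 1, by omega⟩

/-- Bijective fillings of a diagram with `n` entries. -/
abbrev Filling (D : Finset (ℕ × ℕ)) (n : ℕ) : Type := {b // b ∈ D} ≃ Fin n

/-- The filling `s_i · F`, in which the two entries `lo i` and `hi i` are exchanged. -/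
def Filling.swap {D : Finset (ℕ × ℕ)} {n : ℕ} (F : Filling D n) (i : Fin (n - 1)) : Filling D n :=
  F.trans (Equiv.swap (lo i) (hi i))

/-- The cell of the entry `k`. -/
def Filling.pos {D : Finset (ℕ × ℕ)} {n : ℕ} (F : Filling D n) (k : Fin n) : ℕ × ℕ :=
  (F.symm k).1

/-- The set of the entries in the cells with the property `S`. -/
def Filling.entries {D : Finset (ℕ × ℕ)} {n : ℕ} (F : Filling D n) (S : ℕ × ℕ → Prop) :
    Set (Fin n) :=
  {k | S (F.pos k)}

theorem swap_lt_swap {n : ℕ} (i : Fin (n - 1)) {x y : Fin n} (h : x < y)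
    (hne : ¬ (x = lo i ∧ y = hi i)) :
    Equiv.swap (lo i) (hi i) x < Equiv.swap (lo i) (hi i) y := by
  simp only [lo, hi, Fin.ext_iff, Fin.lt_def, Equiv.swap_apply_def] at h hne ⊢
  split_ifs <;> (try simp only) <;> omega

theorem Filling.pos_apply {D : Finset (ℕ × ℕ)} {n : ℕ} (F : Filling D n) (b : {b // b ∈ D}) :
    F.pos (F b) = b.1 := by simp [Filling.pos]

theorem Filling.pos_swap {D : Finset (ℕ × ℕ)} {n : ℕ} (F : Filling D n) (i : Fin (n - 1))
    (k : Fin n) : (F.swap i).pos k = F.pos (Equiv.swap (lo i) (hi i) k) := by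
  simp [Filling.pos, Filling.swap]

/-- Standard ribbon tableaux of shape `β`: rows increase from left to right and columns increase
from top to bottom (remember that heights are counted from the bottom). -/
@[ext] structure SRT {n : ℕ} (β : GenComposition n) where
  filling : Filling (genRibbonCells β.summands) n
  row_lt : ∀ b b', b.1.1 = b'.1.1 → b.1.2 < b'.1.2 → filling b < filling b'
  col_lt : ∀ b b', b.1.2 = b'.1.2 → b'.1.1 < b.1.1 → filling b < filling b'

/-- Standard immaculate tableaux of shape `α`: rows increase from left to right and the first
column increases from top to bottom. -/
@[ext] structure SIT {n : ℕ} (α : Composition n) where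
  filling : Filling (compCells α) n
  row_lt : ∀ b b', b.1.1 = b'.1.1 → b.1.2 < b'.1.2 → filling b < filling b'
  col_lt : ∀ b b', b.1.2 = 0 → b'.1.2 = 0 → b.1.1 < b'.1.1 → filling b < filling b'

/-- Descents of a standard ribbon tableau: `i` appears weakly below `i + 1`. -/
def SRT.IsDescent {n : ℕ} {β : GenComposition n} (T : SRT β) (i : Fin (n - 1)) : Prop :=
  (T.filling.pos (lo i)).1 ≤ (T.filling.pos (hi i)).1

instance {n : ℕ} {β : GenComposition n} (T : SRT β) (i : Fin (n - 1)) :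
    Decidable (T.IsDescent i) := inferInstanceAs (Decidable (_ ≤ _))

/-- The entries `i` and `i + 1` of a standard ribbon tableau are in the same row. -/
def SRT.SameRow {n : ℕ} {β : GenComposition n} (T : SRT β) (i : Fin (n - 1)) : Prop :=
  (T.filling.pos (lo i)).1 = (T.filling.pos (hi i)).1

instance {n : ℕ} {β : GenComposition n} (T : SRT β) (i : Fin (n - 1)) :
    Decidable (T.SameRow i) := inferInstanceAs (Decidable (_ = _))

/-- Descents of a standard immaculate tableau: `i` appears strictly above `i + 1`. -/
def SIT.IsDescent {n : ℕ} {α : Composition n} (T : SIT α) (i : Fin (n - 1)) : Prop :=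
  (T.filling.pos (lo i)).1 < (T.filling.pos (hi i)).1

instance {n : ℕ} {α : Composition n} (T : SIT α) (i : Fin (n - 1)) :
    Decidable (T.IsDescent i) := inferInstanceAs (Decidable (_ < _))

/-- The entries `i` and `i + 1` of a standard immaculate tableau are both in the first column. -/
def SIT.FirstCol {n : ℕ} {α : Composition n} (T : SIT α) (i : Fin (n - 1)) : Prop :=
  (T.filling.pos (lo i)).2 = 0 ∧ (T.filling.pos (hi i)).2 = 0

instance {n : ℕ} {α : Composition n} (T : SIT α) (i : Fin (n - 1)) :
    Decidable (T.FirstCol i) := inferInstanceAs (Decidable (_ ∧ _))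

/-- The standard ribbon tableau `s_i · T`, if `i` appears strictly below `i + 1` in `T`. -/
def SRT.swap {n : ℕ} {β : GenComposition n} (T : SRT β) (i : Fin (n - 1))
    (hd : T.IsDescent i) (hr : ¬ T.SameRow i) : SRT β where
  filling := T.filling.swap i
  row_lt b b' h h' := by
    refine swap_lt_swap i (T.row_lt b b' h h') ?_
    rintro ⟨h1, h2⟩
    apply hr
    rw [SRT.SameRow, ← h1, ← h2, Filling.pos_apply, Filling.pos_apply, h]
  col_lt b b' h h' := by
    refine swap_lt_swap i (T.col_lt b b' h h') ?_
    rintro ⟨h1, h2⟩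
    rw [SRT.IsDescent, ← h1, ← h2, Filling.pos_apply, Filling.pos_apply] at hd
    omega

/-- The standard immaculate tableau `s_i · T`, if `i` appears strictly above `i + 1` in `T` and
they are not both in the first column. -/
def SIT.swap {n : ℕ} {α : Composition n} (T : SIT α) (i : Fin (n - 1))
    (hd : T.IsDescent i) (hc : ¬ T.FirstCol i) : SIT α where
  filling := T.filling.swap i
  row_lt b b' h h' := by
    refine swap_lt_swap i (T.row_lt b b' h h') ?_
    rintro ⟨h1, h2⟩
    rw [SIT.IsDescent, ← h1, ← h2, Filling.pos_apply, Filling.pos_apply] at hd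
    omega
  col_lt b b' h h0 h' := by
    refine swap_lt_swap i (T.col_lt b b' h h0 h') ?_
    rintro ⟨h1, h2⟩
    apply hc
    rw [SIT.FirstCol, ← h1, ← h2, Filling.pos_apply, Filling.pos_apply]
    exact ⟨h, h0⟩

/-! ### The 0-Hecke algebra -/

/-- The defining relations of the 0-Hecke algebra. -/
inductive HeckeRel (n : ℕ) :
    FreeAlgebra ℂ (Fin (n - 1)) → FreeAlgebra ℂ (Fin (n - 1)) → Prop
  | idem (i : Fin (n - 1)) :
      HeckeRel n (FreeAlgebra.ι ℂ i * FreeAlgebra.ι ℂ i) (FreeAlgebra.ι ℂ i)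
  | braid (i j : Fin (n - 1)) (h : i.1 + 1 = j.1) :
      HeckeRel n (FreeAlgebra.ι ℂ i * FreeAlgebra.ι ℂ j * FreeAlgebra.ι ℂ i)
        (FreeAlgebra.ι ℂ j * FreeAlgebra.ι ℂ i * FreeAlgebra.ι ℂ j)
  | comm (i j : Fin (n - 1)) (h : i.1 + 2 ≤ j.1) :
      HeckeRel n (FreeAlgebra.ι ℂ i * FreeAlgebra.ι ℂ j)
        (FreeAlgebra.ι ℂ j * FreeAlgebra.ι ℂ i)

/-- The 0-Hecke algebra `H_n(0)` over `ℂ`. -/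
def ZeroHecke (n : ℕ) : Type := RingQuot (HeckeRel n)

noncomputable section

instance (n : ℕ) : Ring (ZeroHecke n) := inferInstanceAs (Ring (RingQuot (HeckeRel n)))

instance (n : ℕ) : Algebra ℂ (ZeroHecke n) :=
  inferInstanceAs (Algebra ℂ (RingQuot (HeckeRel n)))

/-- The generator `π_i`. -/
def heckePi {n : ℕ} (i : Fin (n - 1)) : ZeroHecke n :=
  RingQuot.mkAlgHom ℂ (HeckeRel n) (FreeAlgebra.ι ℂ i)

/-! ### The modules -/

/-- The linear operator on the space with basis `X` that sends `x` to `f x`, where `none` stands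
for `0`. -/
def partialOp {X : Type} (f : X → Option X) : Module.End ℂ (X →₀ ℂ) :=
  Finsupp.linearCombination ℂ (fun x => (f x).elim 0 (fun y => Finsupp.single y 1))

theorem partialOp_single {X : Type} (f : X → Option X) (x : X) :
    partialOp f (Finsupp.single x 1) = (f x).elim 0 (fun y => Finsupp.single y 1) := by
  simp [partialOp]

theorem partialOp_mul {X : Type} (f g : X → Option X) :
    partialOp f * partialOp g = partialOp (fun x => (g x).bind f) := by
  ext1 x
  ext1
  simp only [LinearMap.coe_comp, Function.comp_apply, Finsupp.lsingle_apply, Module.End.mul_apply,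
    partialOp_single]
  cases h : g x <;> simp [partialOp_single]

/-- The representation of the 0-Hecke algebra given by operators that satisfy its relations. -/
def heckeRep {n : ℕ} {X : Type} (s : Fin (n - 1) → X → Option X)
    (h1 : ∀ i x, (s i x).bind (s i) = s i x)
    (h2 : ∀ i j : Fin (n - 1), i.1 + 1 = j.1 → ∀ x,
      ((s i x).bind (s j)).bind (s i) = ((s j x).bind (s i)).bind (s j))
    (h3 : ∀ i j : Fin (n - 1), i.1 + 2 ≤ j.1 → ∀ x, (s j x).bind (s i) = (s i x).bind (s j)) :
    ZeroHecke n →ₐ[ℂ] Module.End ℂ (X →₀ ℂ) :=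
  RingQuot.liftAlgHom ℂ ⟨FreeAlgebra.lift ℂ (fun i => partialOp (s i)), by
    intro x y h
    cases h with
    | idem i => simp [partialOp_mul, h1]
    | braid i j h =>
      simp only [map_mul, FreeAlgebra.lift_ι_apply, partialOp_mul]
      congr 1
      funext x
      have := h2 i j h x
      simpa [Option.bind_assoc] using this
    | comm i j h => simp [partialOp_mul, h3 i j h]⟩

theorem heckeRep_heckePi {n : ℕ} {X : Type} (s : Fin (n - 1) → X → Option X) (h1 h2 h3)
    (i : Fin (n - 1)) : heckeRep s h1 h2 h3 (heckePi i) = partialOp (s i) := by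
  simp only [heckeRep, heckePi]
  erw [RingQuot.liftAlgHom_mkAlgHom_apply]
  simp

/-- The action of `π_i` on a standard ribbon tableau, where `none` stands for `0`. -/
def SRT.act {n : ℕ} {β : GenComposition n} (i : Fin (n - 1)) (T : SRT β) : Option (SRT β) :=
  if hd : T.IsDescent i then
    if hr : T.SameRow i then none else some (T.swap i hd hr)
  else some T

/-- The action of `π_i` on a standard immaculate tableau, where `none` stands for `0`. -/
def SIT.act {n : ℕ} {α : Composition n} (i : Fin (n - 1)) (T : SIT α) : Option (SIT α) :=
  if hd : T.IsDescent i then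
    if hc : T.FirstCol i then none else some (T.swap i hd hc)
  else some T

/-- Auxiliary: the common form of the two actions, on arbitrary fillings. -/
def fillingAct {D : Finset (ℕ × ℕ)} {n : ℕ} (desc kill : ℕ × ℕ → ℕ × ℕ → Bool) (i : Fin (n - 1))
    (F : Filling D n) : Option (Filling D n) :=
  if desc (F.pos (lo i)) (F.pos (hi i)) then
    if kill (F.pos (lo i)) (F.pos (hi i)) then none else some (F.swap i)
  else some F

theorem SRT.act_map {n : ℕ} {β : GenComposition n} (i : Fin (n - 1)) (T : SRT β) :
    (SRT.act i T).map SRT.filling =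
      fillingAct (fun p q => p.1 ≤ q.1) (fun p q => p.1 = q.1) i T.filling := by
  by_cases hd : T.IsDescent i
  · by_cases hk : T.SameRow i
    · have hd' := hd
      have hk' := hk
      simp only [SRT.IsDescent, SRT.SameRow] at hd' hk'
      simp [SRT.act, fillingAct, hd, hk, hk']
    · have hd' := hd
      have hk' := hk
      simp only [SRT.IsDescent, SRT.SameRow] at hd' hk'
      simp [SRT.act, fillingAct, hd, hk, hd', hk', SRT.swap]
  · have hd' := hd
    simp only [SRT.IsDescent] at hd'
    simp [SRT.act, fillingAct, hd, hd']

theorem SIT.act_map {n : ℕ} {α : Composition n} (i : Fin (n - 1)) (T : SIT α) :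
    (SIT.act i T).map SIT.filling =
      fillingAct (fun p q => p.1 < q.1) (fun p q => p.2 = 0 ∧ q.2 = 0) i T.filling := by
  by_cases hd : T.IsDescent i
  · by_cases hk : T.FirstCol i
    · have hd' := hd
      have hk' := hk
      simp only [SIT.IsDescent, SIT.FirstCol] at hd' hk'
      simp [SIT.act, fillingAct, hd, hk, hd', hk']
    · have hd' := hd
      have hk' := hk
      simp only [SIT.IsDescent, SIT.FirstCol] at hd' hk'
      simp [SIT.act, fillingAct, hd, hk, hd', hk', SIT.swap]
  · have hd' := hd
    simp only [SIT.IsDescent] at hd'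
    simp [SIT.act, fillingAct, hd, hd']

theorem SRT.filling_injective {n : ℕ} {β : GenComposition n} :
    Function.Injective (SRT.filling (β := β)) := fun _ _ h => SRT.ext h

theorem SIT.filling_injective {n : ℕ} {α : Composition n} :
    Function.Injective (SIT.filling (α := α)) := fun _ _ h => SIT.ext h

theorem bind_map_of_map {X Y : Type} {f : X → Y} {s : X → Option X} {t : Y → Option Y}
    (h : ∀ x, (s x).map f = t (f x)) (o : Option X) : (o.bind s).map f = (o.map f).bind t := by
  cases o <;> simp [h]

theorem swap_swap_comm {D : Finset (ℕ × ℕ)} {n : ℕ} (F : Filling D n) (i j : Fin (n - 1))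
    (h : i.1 + 2 ≤ j.1) : (F.swap j).swap i = (F.swap i).swap j := by
  have hd : Equiv.swap (lo i) (hi i) * Equiv.swap (lo j) (hi j) =
      Equiv.swap (lo j) (hi j) * Equiv.swap (lo i) (hi i) := by
    refine (Equiv.Perm.Disjoint.commute ?_).eq
    intro x
    by_cases hx : x = lo i ∨ x = hi i
    · right
      apply Equiv.swap_apply_of_ne_of_ne <;>
        simp only [lo, hi, Fin.ext_iff, ne_eq] at hx ⊢ <;> omega
    · left
      rw [not_or] at hx
      exact Equiv.swap_apply_of_ne_of_ne hx.1 hx.2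
  apply Equiv.ext
  intro b
  exact Equiv.congr_fun hd (F b)

theorem swap_swap_braid {D : Finset (ℕ × ℕ)} {n : ℕ} (F : Filling D n) (i j : Fin (n - 1))
    (h : i.1 + 1 = j.1) : ((F.swap i).swap j).swap i = ((F.swap j).swap i).swap j := by
  have hj : lo j = hi i := by simp [lo, hi, ← h]
  have n1 : lo i ≠ hi i := by simp [lo, hi, Fin.ext_iff]
  have n2 : lo i ≠ hi j := by simp [lo, hi, Fin.ext_iff] <;> omega
  have n3 : hi i ≠ hi j := by simp [lo, hi, Fin.ext_iff] <;> omega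
  have hd : Equiv.swap (lo i) (hi i) * Equiv.swap (lo j) (hi j) * Equiv.swap (lo i) (hi i) =
      Equiv.swap (lo j) (hi j) * Equiv.swap (lo i) (hi i) * Equiv.swap (lo j) (hi j) := by
    rw [hj, Equiv.swap_mul_swap_mul_swap n1 n2, Equiv.swap_comm (lo i) (hi i),
      Equiv.swap_comm (hi i) (hi j), Equiv.swap_mul_swap_mul_swap n3.symm n2.symm,
      Equiv.swap_comm]
  apply Equiv.ext
  intro b
  exact Equiv.congr_fun hd (F b)

theorem fillingAct_idem {D : Finset (ℕ × ℕ)} {n : ℕ} (desc kill : ℕ × ℕ → ℕ × ℕ → Bool)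
    (hk : ∀ p q, desc p q → kill p q = false → desc q p = false)
    (i : Fin (n - 1)) (F : Filling D n) :
    (fillingAct desc kill i F).bind (fillingAct desc kill i) = fillingAct desc kill i F := by
  have := hk (F.pos (lo i)) (F.pos (hi i))
  simp only [fillingAct]
  split_ifs <;> simp_all [fillingAct, Filling.pos_swap]

theorem fillingAct_comm {D : Finset (ℕ × ℕ)} {n : ℕ} (desc kill : ℕ × ℕ → ℕ × ℕ → Bool)
    (i j : Fin (n - 1)) (h : i.1 + 2 ≤ j.1) (F : Filling D n) :
    (fillingAct desc kill j F).bind (fillingAct desc kill i) =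
      (fillingAct desc kill i F).bind (fillingAct desc kill j) := by
  have e1 : Equiv.swap (lo i) (hi i) (lo j) = lo j := by
    apply Equiv.swap_apply_of_ne_of_ne <;> simp [lo, hi, Fin.ext_iff] <;> omega
  have e2 : Equiv.swap (lo i) (hi i) (hi j) = hi j := by
    apply Equiv.swap_apply_of_ne_of_ne <;> simp [lo, hi, Fin.ext_iff] <;> omega
  have e3 : Equiv.swap (lo j) (hi j) (lo i) = lo i := by
    apply Equiv.swap_apply_of_ne_of_ne <;> simp [lo, hi, Fin.ext_iff] <;> omega
  have e4 : Equiv.swap (lo j) (hi j) (hi i) = hi i := by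
    apply Equiv.swap_apply_of_ne_of_ne <;> simp [lo, hi, Fin.ext_iff] <;> omega
  have e5 := swap_swap_comm F i j h
  simp only [fillingAct]
  split_ifs <;> simp_all [fillingAct, Filling.pos_swap]

theorem fillingAct_braid {D : Finset (ℕ × ℕ)} {n : ℕ} (desc kill : ℕ × ℕ → ℕ × ℕ → Bool)
    (h1 : ∀ p q, desc p q → kill p q = false → desc q p = false)
    (h2 : ∀ p q r, desc p q → desc q r → desc p r)
    (h3 : ∀ p q r, desc p q = false → desc q r = false → desc p r = false)
    (i j : Fin (n - 1)) (h : i.1 + 1 = j.1) (F : Filling D n) :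
    ((fillingAct desc kill i F).bind (fillingAct desc kill j)).bind (fillingAct desc kill i) =
      ((fillingAct desc kill j F).bind (fillingAct desc kill i)).bind
        (fillingAct desc kill j) := by
  have hj : lo j = hi i := by simp [lo, hi, ← h]
  have n1 : lo i ≠ hi i := by simp [lo, hi, Fin.ext_iff]
  have n2 : lo i ≠ hi j := by simp [lo, hi, Fin.ext_iff] <;> omega
  have n3 : hi i ≠ hi j := by simp [lo, hi, Fin.ext_iff] <;> omega
  have e1 : Equiv.swap (lo i) (hi i) (hi j) = hi j :=
    Equiv.swap_apply_of_ne_of_ne n2.symm n3.symm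
  have e2 : Equiv.swap (hi i) (hi j) (lo i) = lo i := Equiv.swap_apply_of_ne_of_ne n1 n2
  have e5 := swap_swap_braid F i j h
  have a1 := h1 (F.pos (lo i)) (F.pos (hi i))
  have a2 := h1 (F.pos (hi i)) (F.pos (hi j))
  have a3 := h2 (F.pos (lo i)) (F.pos (hi i)) (F.pos (hi j))
  have a4 := h3 (F.pos (lo i)) (F.pos (hi i)) (F.pos (hi j))
  cases d1 : desc (F.pos (lo i)) (F.pos (hi i)) <;>
    cases d2 : desc (F.pos (hi i)) (F.pos (hi j)) <;>
    cases d3 : desc (F.pos (lo i)) (F.pos (hi j)) <;>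
    cases k1 : kill (F.pos (lo i)) (F.pos (hi i)) <;>
    cases k2 : kill (F.pos (hi i)) (F.pos (hi j)) <;>
    cases k3 : kill (F.pos (lo i)) (F.pos (hi j)) <;>
    first
    | exact (Bool.false_ne_true (d3.symm.trans (a3 d1 d2))).elim
    | exact (Bool.false_ne_true ((a4 d1 d2).symm.trans d3)).elim
    | simp [fillingAct, Filling.pos_swap, hj, e1, e2, d1, d2, d3, k1, k2, k3, a1, a2, e5]

theorem SRT.act_idem {n : ℕ} {β : GenComposition n} (i : Fin (n - 1)) (T : SRT β) :
    (SRT.act i T).bind (SRT.act i) = SRT.act i T := by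
  apply Option.map_injective SRT.filling_injective
  rw [bind_map_of_map (SRT.act_map i), SRT.act_map]
  apply fillingAct_idem
  simp
  omega

theorem SRT.act_comm {n : ℕ} {β : GenComposition n} (i j : Fin (n - 1)) (h : i.1 + 2 ≤ j.1)
    (T : SRT β) : (SRT.act j T).bind (SRT.act i) = (SRT.act i T).bind (SRT.act j) := by
  apply Option.map_injective SRT.filling_injective
  rw [bind_map_of_map (SRT.act_map i), bind_map_of_map (SRT.act_map j), SRT.act_map, SRT.act_map]
  exact fillingAct_comm _ _ i j h _

theorem SRT.act_braid {n : ℕ} {β : GenComposition n} (i j : Fin (n - 1)) (h : i.1 + 1 = j.1)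
    (T : SRT β) : ((SRT.act i T).bind (SRT.act j)).bind (SRT.act i) =
      ((SRT.act j T).bind (SRT.act i)).bind (SRT.act j) := by
  apply Option.map_injective SRT.filling_injective
  simp only [bind_map_of_map (SRT.act_map i), bind_map_of_map (SRT.act_map j), SRT.act_map]
  apply fillingAct_braid _ _ ?_ ?_ ?_ i j h
  all_goals simp
  all_goals omega

theorem SIT.act_idem {n : ℕ} {α : Composition n} (i : Fin (n - 1)) (T : SIT α) :
    (SIT.act i T).bind (SIT.act i) = SIT.act i T := by
  apply Option.map_injective SIT.filling_injective
  rw [bind_map_of_map (SIT.act_map i), SIT.act_map]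
  apply fillingAct_idem
  simp
  omega

theorem SIT.act_comm {n : ℕ} {α : Composition n} (i j : Fin (n - 1)) (h : i.1 + 2 ≤ j.1)
    (T : SIT α) : (SIT.act j T).bind (SIT.act i) = (SIT.act i T).bind (SIT.act j) := by
  apply Option.map_injective SIT.filling_injective
  rw [bind_map_of_map (SIT.act_map i), bind_map_of_map (SIT.act_map j), SIT.act_map, SIT.act_map]
  exact fillingAct_comm _ _ i j h _

theorem SIT.act_braid {n : ℕ} {α : Composition n} (i j : Fin (n - 1)) (h : i.1 + 1 = j.1)
    (T : SIT α) : ((SIT.act i T).bind (SIT.act j)).bind (SIT.act i) =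
      ((SIT.act j T).bind (SIT.act i)).bind (SIT.act j) := by
  apply Option.map_injective SIT.filling_injective
  simp only [bind_map_of_map (SIT.act_map i), bind_map_of_map (SIT.act_map j), SIT.act_map]
  apply fillingAct_braid _ _ ?_ ?_ ?_ i j h
  all_goals simp
  all_goals omega

/-- The `H_n(0)`-module `P_β` with basis the standard ribbon tableaux of shape `β`. -/
def RibbonModule {n : ℕ} (β : GenComposition n) : Type := SRT β →₀ ℂ

instance {n : ℕ} (β : GenComposition n) : AddCommGroup (RibbonModule β) :=
  inferInstanceAs (AddCommGroup (SRT β →₀ ℂ))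

instance {n : ℕ} (β : GenComposition n) : Module ℂ (RibbonModule β) :=
  inferInstanceAs (Module ℂ (SRT β →₀ ℂ))

/-- The representation of `H_n(0)` on `P_β`. -/
def RibbonModule.rep {n : ℕ} (β : GenComposition n) :
    ZeroHecke n →ₐ[ℂ] Module.End ℂ (RibbonModule β) :=
  heckeRep SRT.act SRT.act_idem SRT.act_braid SRT.act_comm

instance {n : ℕ} (β : GenComposition n) : Module (ZeroHecke n) (RibbonModule β) :=
  Module.compHom (RibbonModule β) (RibbonModule.rep β).toRingHom

/-- The basis vector of `P_β` that belongs to a standard ribbon tableau. -/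
def RibbonModule.of {n : ℕ} {β : GenComposition n} (T : SRT β) : RibbonModule β :=
  Finsupp.single T (1 : ℂ)

/-- The `H_n(0)`-module `V_α` with basis the standard immaculate tableaux of shape `α`. -/
def ImmaculateModule {n : ℕ} (α : Composition n) : Type := SIT α →₀ ℂ

instance {n : ℕ} (α : Composition n) : AddCommGroup (ImmaculateModule α) :=
  inferInstanceAs (AddCommGroup (SIT α →₀ ℂ))

instance {n : ℕ} (α : Composition n) : Module ℂ (ImmaculateModule α) :=
  inferInstanceAs (Module ℂ (SIT α →₀ ℂ))

/-- The representation of `H_n(0)` on `V_α`. -/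
def ImmaculateModule.rep {n : ℕ} (α : Composition n) :
    ZeroHecke n →ₐ[ℂ] Module.End ℂ (ImmaculateModule α) :=
  heckeRep SIT.act SIT.act_idem SIT.act_braid SIT.act_comm

instance {n : ℕ} (α : Composition n) : Module (ZeroHecke n) (ImmaculateModule α) :=
  Module.compHom (ImmaculateModule α) (ImmaculateModule.rep α).toRingHom

/-- The basis vector of `V_α` that belongs to a standard immaculate tableau. -/
def ImmaculateModule.of {n : ℕ} {α : Composition n} (T : SIT α) : ImmaculateModule α :=
  Finsupp.single T (1 : ℂ)

theorem RibbonModule.heckePi_smul_of {n : ℕ} {β : GenComposition n} (i : Fin (n - 1))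
    (T : SRT β) : heckePi i • RibbonModule.of T = (SRT.act i T).elim 0 RibbonModule.of := by
  change (heckeRep SRT.act SRT.act_idem SRT.act_braid SRT.act_comm (heckePi i))
    (Finsupp.single T 1) = _
  rw [heckeRep_heckePi, partialOp_single]
  rfl

theorem ImmaculateModule.heckePi_smul_of {n : ℕ} {α : Composition n} (i : Fin (n - 1))
    (T : SIT α) :
    heckePi i • ImmaculateModule.of T = (SIT.act i T).elim 0 ImmaculateModule.of := by
  change (heckeRep SIT.act SIT.act_idem SIT.act_braid SIT.act_comm (heckePi i))
    (Finsupp.single T 1) = _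
  rw [heckeRep_heckePi, partialOp_single]
  rfl

instance {n : ℕ} (β : GenComposition n) : IsScalarTower ℂ (ZeroHecke n) (RibbonModule β) where
  smul_assoc c h v := by
    change (RibbonModule.rep β (c • h)) v = c • (RibbonModule.rep β h) v
    rw [map_smul]
    rfl

instance {n : ℕ} (α : Composition n) : IsScalarTower ℂ (ZeroHecke n) (ImmaculateModule α) where
  smul_assoc c h v := by
    change (ImmaculateModule.rep α (c • h)) v = c • (ImmaculateModule.rep α h) v
    rw [map_smul]
    rfl

end

/-! ### Strips and the tableau attached to a standard immaculate tableau -/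

/-- The increasing list `k₁ < ⋯ < k_m` of the indices (starting from `0`) of the rows of the
composition diagram of `α` with more than one cell. -/
def longRows {n : ℕ} (α : Composition n) : List ℕ :=
  (List.range α.length).filter (fun r => 1 < α.blocks.getD r 0)

/-- The strips of the composition diagram of `α`: the strip `0` is the first column, and for
`1 ≤ j ≤ m` the strip `j` is the row `k_j` without its leftmost cell. -/
def compStrip {n : ℕ} (α : Composition n) : ℕ → ℕ × ℕ → Prop
  | 0, b => b ∈ compCells α ∧ b.2 = 0
  | j + 1, b => b ∈ compCells α ∧ (longRows α)[j]? = some b.1 ∧ b.2 ≠ 0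

/-- The cells in the topmost row of the generalized ribbon diagram of `β`. -/
def topRow {n : ℕ} (β : GenComposition n) (b : ℕ × ℕ) : Prop :=
  b ∈ genRibbonCells β.summands ∧ ∀ b' ∈ genRibbonCells β.summands, b'.1 ≤ b.1

/-- The corresponding strips of the ribbon diagram of `α.tilde`: the strip `0` is the topmost row,
and for `1 ≤ j ≤ m` the strip `j` is the `j`-th column from the left without its cell in the
topmost row (such a cell only exists for `j = m`). -/
def ribbonStrip {n : ℕ} (α : Composition n) : ℕ → ℕ × ℕ → Prop
  | 0, b => topRow α.tilde b
  | j + 1, b => b ∈ genRibbonCells α.tilde.summands ∧ b.2 = j ∧ ¬ topRow α.tilde b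

/-- `R` is the ribbon tableau `T^𝒯` attached to the standard immaculate tableau `T = 𝒯`: it has
the same entries as `T` in the strip `j`, for `0 ≤ j ≤ m`. -/
def IsRibbonTableauOf {n : ℕ} {α : Composition n} (T : SIT α) (R : SRT α.tilde) : Prop :=
  ∀ j ≤ (longRows α).length,
    R.filling.entries (ribbonStrip α j) = T.filling.entries (compStrip α j)

/-! ### Injective hulls and socles -/

/-- A homomorphism `f : M → I` is an injective hull: it is injective, `I` is an injective module,
and `I` is an essential extension of the image of `f`. -/
structure IsInjectiveHull {R M I : Type} [Ring R] [AddCommGroup M] [AddCommGroup I] [Module R M]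
    [Module R I] (f : M →ₗ[R] I) : Prop where
  injective : Function.Injective f
  injective_module : Module.Injective R I
  essential : ∀ X : Submodule R I, X ≠ ⊥ → X ⊓ LinearMap.range f ≠ ⊥

/-- The socle of a module: the sum of all its simple submodules. -/
def moduleSocle (R M : Type) [Ring R] [AddCommGroup M] [Module R M] : Submodule R M :=
  sSup {S : Submodule R M | IsSimpleModule R S}

/-!
The diagrams of `α` and of `α.tilde` have corresponding cells (`toComp`): the first column
corresponds to the topmost row, and each long row without its leftmost cell to a column. Moving the
entries of a standard immaculate tableau along this correspondence gives a standard ribbon tableau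
(`SIT.toSRT`), the only one with the same entries in the strips (`SRT.eq_of_entries_eq`), and the
rules for the action of `π_i` agree (`SIT.act_toSRT`). The image of this embedding contains all
standard ribbon tableaux whose topmost row consists of the smallest entries
(`SRT.TopFirst.exists_toSRT`).

*Injectivity of the ribbon module.* A ribbon diagram runs monotonically to the north-east, so its
fillings are words. If no condition is imposed on the words, the resulting module is injective: it
has dimension `n!`, the algebra has dimension at most `n!` (`finrank_zeroHecke_le`), and the
functional that takes the coefficient of the decreasing word vanishes on no nonzero submodule, so
that the module is isomorphic to the dual of the algebra (`injective_wordAction`). Words with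
prescribed descents at some consecutive places span a submodule, which is a direct summand by
sorting the words (`injectiveCut_descends`); sorting commutes with the action because it is a power
of a product of generators acting on the right. Prescribing an ascent at a further place amounts to
taking the quotient by the words that have a descent there. Both the module and the submodule are
injective by induction, hence so is the quotient (`injectiveCut_or`). A standard ribbon tableau is
a word with descents along the columns and ascents along the rows (`SRT.act_eq_cut`).

*Essentiality.* Since every `π_i` is triangular with diagonal entries `0` and `1`, each nonzero
submodule contains a common eigenvector (`HeckeAction.exists_eigenvector`). If `π_i` moves a tableau
in the support of an eigenvector `v`, then `π_i v = 0`, and the result of the move is in the support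
as well. If some tableau in the support had an entry in the topmost row that is larger than an entry
elsewhere, such moves and their inverses would lead to a tableau in the support in which `1` and `2`
are in the same column while `π_1 v = 0`; but nothing can cancel this tableau in `π_1 v`
(`not_kill_of_corner`).
So `v` lies in the image of the embedding. A simple submodule that meets the image is contained
in it, which gives the statement on the socle.
-/

noncomputable section

/-! ### Partial actions of the 0-Hecke generators -/

/-- The linear map between spaces with bases `X` and `Y` that sends the basis vector `x` to the
basis vector `φ x`, where `none` stands for `0`. -/
def partialLin {X Y : Type} (φ : X → Option Y) : (X →₀ ℂ) →ₗ[ℂ] (Y →₀ ℂ) :=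
  Finsupp.linearCombination ℂ (fun x => (φ x).elim 0 (fun y => Finsupp.single y 1))

theorem partialLin_single {X Y : Type} (φ : X → Option Y) (x : X) :
    partialLin φ (Finsupp.single x 1) = (φ x).elim 0 (fun y => Finsupp.single y 1) := by
  simp [partialLin]

theorem partialLin_comp {X Y Z : Type} (φ : X → Option Y) (ψ : Y → Option Z) :
    partialLin ψ ∘ₗ partialLin φ = partialLin (fun x => (φ x).bind ψ) := by
  ext1 x
  ext1
  simp only [LinearMap.coe_comp, Function.comp_apply, Finsupp.lsingle_apply, partialLin_single]
  cases h : φ x <;> simp [partialLin_single]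

theorem partialLin_some {X : Type} : partialLin (some : X → Option X) = LinearMap.id := by
  ext1 x
  ext1
  simp [partialLin_single]

open Classical in
theorem partialLin_apply {X Y : Type} (φ : X → Option Y) (v : X →₀ ℂ) (y : Y) :
    partialLin φ v y = v.sum fun x c => if φ x = some y then c else 0 := by
  rw [partialLin, Finsupp.linearCombination_apply, Finsupp.sum_apply]
  refine Finsupp.sum_congr fun x _ => ?_
  cases h : φ x with
  | none => simp
  | some z => simp [Finsupp.single_apply]

/-- If `x` is the only basis element of the support that `φ` sends to `y`, the coefficients at `x`
and at `y` agree. -/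
theorem partialLin_apply_of_unique {X Y : Type} (φ : X → Option Y) (v : X →₀ ℂ) {x : X} {y : Y}
    (hx : φ x = some y) (hu : ∀ x', v x' ≠ 0 → φ x' = some y → x' = x) :
    partialLin φ v y = v x := by
  classical
  rw [partialLin_apply, Finsupp.sum, Finset.sum_eq_single x]
  · simp [hx]
  · intro b hb hne
    rw [if_neg]
    exact fun h => hne (hu b (by simpa using hb) h)
  · intro h
    rw [Finsupp.notMem_support_iff] at h
    simp [h]

theorem partialLin_apply_eq_zero {X Y : Type} (φ : X → Option Y) (v : X →₀ ℂ) {y : Y}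
    (hu : ∀ x, v x ≠ 0 → φ x ≠ some y) : partialLin φ v y = 0 := by
  classical
  rw [partialLin_apply, Finsupp.sum]
  refine Finset.sum_eq_zero fun x hx => ?_
  rw [if_neg (hu x (by simpa using hx))]

/-- An action of the 0-Hecke generators on a set by partial maps satisfying the 0-Hecke relations;
`none` stands for `0`. -/
structure HeckeAction (n : ℕ) (X : Type) where
  s : Fin (n - 1) → X → Option X
  idem : ∀ i x, (s i x).bind (s i) = s i x
  braid : ∀ i j : Fin (n - 1), i.1 + 1 = j.1 → ∀ x,
    ((s i x).bind (s j)).bind (s i) = ((s j x).bind (s i)).bind (s j)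
  comm : ∀ i j : Fin (n - 1), i.1 + 2 ≤ j.1 → ∀ x, (s j x).bind (s i) = (s i x).bind (s j)

namespace HeckeAction

variable {n : ℕ} {X Y Z : Type}

/-- The `H_n(0)`-module with basis `X` attached to a partial action on `X`. -/
def Mod (_ : HeckeAction n X) : Type := X →₀ ℂ

variable (A : HeckeAction n X) (B : HeckeAction n Y)

instance : AddCommGroup A.Mod := inferInstanceAs (AddCommGroup (X →₀ ℂ))

instance : Module ℂ A.Mod := inferInstanceAs (Module ℂ (X →₀ ℂ))

/-- The representation of `H_n(0)` attached to a partial action. -/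
def rep : ZeroHecke n →ₐ[ℂ] Module.End ℂ A.Mod :=
  heckeRep A.s A.idem A.braid A.comm

instance : Module (ZeroHecke n) A.Mod := Module.compHom A.Mod A.rep.toRingHom

instance : IsScalarTower ℂ (ZeroHecke n) A.Mod where
  smul_assoc c h v := by
    change (A.rep (c • h)) v = c • (A.rep h) v
    rw [map_smul]
    rfl

/-- The coefficients of a vector. -/
def coeff : A.Mod ≃ₗ[ℂ] (X →₀ ℂ) := LinearEquiv.refl ℂ (X →₀ ℂ)

theorem coeff_heckePi_smul (i : Fin (n - 1)) (v : A.Mod) :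
    A.coeff ((heckePi i : ZeroHecke n) • v) = partialLin (A.s i) (A.coeff v) := by
  change (heckeRep A.s A.idem A.braid A.comm (heckePi i)) v = _
  rw [heckeRep_heckePi]
  rfl

end HeckeAction

theorem adjoin_range_heckePi (n : ℕ) :
    Algebra.adjoin ℂ (Set.range (heckePi : Fin (n - 1) → ZeroHecke n)) = ⊤ := by
  have h1 : (Set.range (heckePi : Fin (n - 1) → ZeroHecke n)) =
      (RingQuot.mkAlgHom ℂ (HeckeRel n)) '' (Set.range (FreeAlgebra.ι ℂ)) := by
    rw [← Set.range_comp]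
    rfl
  rw [h1]
  let f : FreeAlgebra ℂ (Fin (n - 1)) →ₐ[ℂ] ZeroHecke n := RingQuot.mkAlgHom ℂ (HeckeRel n)
  have hf : f.range = ⊤ := (AlgHom.range_eq_top f).2 (RingQuot.mkAlgHom_surjective ℂ (HeckeRel n))
  change Algebra.adjoin ℂ (f '' _) = ⊤
  rw [← AlgHom.map_adjoin, FreeAlgebra.adjoin_range_ι, Algebra.map_top, hf]

/-- A `ℂ`-linear map that commutes with all `π_i` is `H_n(0)`-linear. -/
def heckeLinear {n : ℕ} {M N : Type} [AddCommGroup M] [AddCommGroup N] [Module ℂ M] [Module ℂ N]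
    [Module (ZeroHecke n) M] [Module (ZeroHecke n) N] [IsScalarTower ℂ (ZeroHecke n) M]
    [IsScalarTower ℂ (ZeroHecke n) N] (f : M →ₗ[ℂ] N)
    (hf : ∀ (i : Fin (n - 1)) (x : M), f ((heckePi i : ZeroHecke n) • x) =
      (heckePi i : ZeroHecke n) • f x) : M →ₗ[ZeroHecke n] N where
  toFun := f
  map_add' := f.map_add
  map_smul' h := by
    have hh : h ∈ Algebra.adjoin ℂ (Set.range (heckePi : Fin (n - 1) → ZeroHecke n)) := by
      rw [adjoin_range_heckePi]
      trivial
    induction hh using Algebra.adjoin_induction with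
    | mem x hx =>
      obtain ⟨i, rfl⟩ := hx
      exact hf i
    | algebraMap r =>
      intro x
      rw [algebraMap_smul, map_smul, RingHom.id_apply, algebraMap_smul]
    | add x y _ _ hx hy =>
      intro z
      simp only [add_smul, map_add, RingHom.id_apply] at hx hy ⊢
      rw [hx, hy]
    | mul x y _ _ hx hy =>
      intro z
      simp only [mul_smul, RingHom.id_apply] at hx hy ⊢
      rw [hx, hy]

namespace HeckeAction

variable {n : ℕ} {X Y Z : Type} (A : HeckeAction n X) (B : HeckeAction n Y)

/-- The homomorphism attached to a partial map that intertwines two partial actions. -/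
def hom (φ : X → Option Y) (h : ∀ i x, (A.s i x).bind φ = (φ x).bind (B.s i)) :
    A.Mod →ₗ[ZeroHecke n] B.Mod :=
  heckeLinear (B.coeff.symm.toLinearMap ∘ₗ partialLin φ ∘ₗ A.coeff.toLinearMap) (by
    intro i v
    apply B.coeff.injective
    simp only [LinearMap.comp_apply, LinearEquiv.coe_coe, coeff_heckePi_smul,
      LinearEquiv.apply_symm_apply]
    rw [← LinearMap.comp_apply, ← LinearMap.comp_apply, partialLin_comp, partialLin_comp]
    simp only [h])

theorem coeff_hom (φ : X → Option Y) (h : ∀ i x, (A.s i x).bind φ = (φ x).bind (B.s i))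
    (v : A.Mod) : B.coeff (A.hom B φ h v) = partialLin φ (A.coeff v) := rfl

/-- If every `π_i` either fixes a basis element or kills it or lowers its rank, each nonzero
submodule contains a common eigenvector: a vector of minimal rank whose part of top rank has the
smallest possible support. -/
theorem exists_eigenvector (r : X → ℕ)
    (hr : ∀ i x y, A.s i x = some y → y = x ∨ r y < r x)
    (W : Submodule (ZeroHecke n) A.Mod) (hW : W ≠ ⊥) :
    ∃ v ∈ W, v ≠ 0 ∧ ∀ i : Fin (n - 1), (heckePi i : ZeroHecke n) • v = v ∨
      (heckePi i : ZeroHecke n) • v = 0 := by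
  classical
  obtain ⟨v₀, hv₀, hv₀0⟩ := (Submodule.ne_bot_iff W).1 hW
  let P : ℕ → A.Mod → Prop := fun d v => v ∈ W ∧ v ≠ 0 ∧ ∀ x, A.coeff v x ≠ 0 → r x < d
  have hP : ∃ d, ∃ v, P d v := by
    refine ⟨(A.coeff v₀).support.sup r + 1, v₀, hv₀, hv₀0, fun x hx => ?_⟩
    exact Nat.lt_succ_of_le (Finset.le_sup (f := r) (Finsupp.mem_support_iff.2 hx))
  let d := Nat.find hP
  have hd : ∃ v, P d v := Nat.find_spec hP
  have hdmin : ∀ v, ∀ d' < d, ¬ P d' v := fun v d' hd' hv => Nat.find_min hP hd' ⟨v, hv⟩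
  let top : A.Mod → Finset X := fun v => (A.coeff v).support.filter fun x => r x + 1 = d
  have hQ : ∃ k, ∃ v, P d v ∧ (top v).card = k := by
    obtain ⟨v, hv⟩ := hd
    exact ⟨_, v, hv, rfl⟩
  obtain ⟨v, hv, hvk⟩ := Nat.find_spec hQ
  have hkmin : ∀ w, P d w → (top v).card ≤ (top w).card := fun w hw => by
    rw [hvk]
    exact Nat.find_min' hQ ⟨w, hw, rfl⟩
  refine ⟨v, hv.1, hv.2.1, fun i => ?_⟩
  by_contra hcon
  rw [not_or] at hcon
  obtain ⟨hne1, hne0⟩ := hcon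
  have hmem := W.smul_mem (heckePi i) hv.1
  -- in rank at least `d - 1`, the operator `π_i` acts on `v` diagonally
  have hfix : ∀ x, d ≤ r x + 1 → A.s i x = some x →
      A.coeff ((heckePi i : ZeroHecke n) • v) x = A.coeff v x := by
    intro x hx hs
    rw [coeff_heckePi_smul]
    refine partialLin_apply_of_unique _ _ hs fun x' hx' hs' => ?_
    rcases hr i x' x hs' with h | h
    · exact h.symm
    · have := hv.2.2 x' hx'
      omega
  have hmove : ∀ x, d ≤ r x + 1 → A.s i x ≠ some x →
      A.coeff ((heckePi i : ZeroHecke n) • v) x = 0 := by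
    intro x hx hs
    rw [coeff_heckePi_smul]
    refine partialLin_apply_eq_zero _ _ fun x' hx' hs' => ?_
    rcases hr i x' x hs' with h | h
    · subst h
      exact hs hs'
    · have := hv.2.2 x' hx'
      omega
  by_cases hall : ∀ x ∈ top v, A.s i x = some x
  · have hd0 : 0 < d := by
      obtain ⟨x, hx⟩ := Finsupp.ne_iff.1 ((map_ne_zero_iff _ A.coeff.injective).2 hv.2.1)
      exact lt_of_le_of_lt (Nat.zero_le _) (hv.2.2 x hx)
    refine hdmin ((heckePi i : ZeroHecke n) • v - v) (d - 1) (by omega)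
      ⟨W.sub_mem hmem hv.1, ?_, ?_⟩
    · exact fun h => hne1 (sub_eq_zero.1 h)
    · intro x hx
      by_contra hlt
      apply hx
      rw [map_sub, Finsupp.sub_apply, sub_eq_zero]
      by_cases hs : A.s i x = some x
      · exact hfix x (by omega) hs
      · rw [hmove x (by omega) hs]
        by_contra h0
        have h1 := hv.2.2 x (Ne.symm h0)
        refine hs (hall x (Finset.mem_filter.2 ⟨Finsupp.mem_support_iff.2 (Ne.symm h0), ?_⟩))
        omega
  · push Not at hall
    obtain ⟨x₀, hx₀, hs₀⟩ := hall
    have hPw : P d ((heckePi i : ZeroHecke n) • v) := by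
      refine ⟨hmem, hne0, fun x hx => ?_⟩
      by_contra hlt
      apply hx
      by_cases hs : A.s i x = some x
      · rw [hfix x (by omega) hs]
        by_contra h0
        exact hlt (hv.2.2 x h0)
      · exact hmove x (by omega) hs
    have hsub : top ((heckePi i : ZeroHecke n) • v) ⊂ top v := by
      rw [Finset.ssubset_iff_of_subset]
      · refine ⟨x₀, hx₀, ?_⟩
        have : r x₀ + 1 = d := (Finset.mem_filter.1 hx₀).2
        simp [top, hmove x₀ (by omega) hs₀]
      · intro x hx
        simp only [top, Finset.mem_filter, Finsupp.mem_support_iff] at hx ⊢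
        refine ⟨?_, hx.2⟩
        by_cases hs : A.s i x = some x
        · rw [← hfix x (by omega) hs]
          exact hx.1
        · exact absurd (hmove x (by omega) hs) hx.1
    exact absurd (hkmin _ hPw) (not_le.2 (Finset.card_lt_card hsub))

/-- If `π_i` does not fix some basis element of the support of an eigenvector, it kills the
eigenvector. -/
theorem smul_eq_zero_of_moved {v : A.Mod} {i : Fin (n - 1)}
    (hv : (heckePi i : ZeroHecke n) • v = v ∨ (heckePi i : ZeroHecke n) • v = 0)
    {x : X} (hx : A.coeff v x ≠ 0) (hs : A.s i x ≠ some x) :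
    (heckePi i : ZeroHecke n) • v = 0 := by
  refine hv.resolve_left fun h => ?_
  rw [← h, coeff_heckePi_smul] at hx
  refine hx (partialLin_apply_eq_zero _ _ fun x' _ hx' => hs ?_)
  have := A.idem i x'
  rwa [hx'] at this

/-- The support of an eigenvector is closed under the moves of basis elements: the coefficients of
`x` and of `π_i x` have sum zero. -/
theorem coeff_ne_zero_of_moved {v : A.Mod} {i : Fin (n - 1)}
    (hv : (heckePi i : ZeroHecke n) • v = v ∨ (heckePi i : ZeroHecke n) • v = 0)
    {x y : X} (hx : A.coeff v x ≠ 0) (hs : A.s i x = some y) (hne : y ≠ x)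
    (hinj : ∀ x', A.s i x' = some y → x' = x ∨ x' = y) : A.coeff v y ≠ 0 := by
  intro hy
  have h0 := A.smul_eq_zero_of_moved hv hx (by simp [hs, hne])
  apply hx
  rw [← partialLin_apply_of_unique (A.s i) (A.coeff v) hs, ← coeff_heckePi_smul, h0]
  · simp
  · intro x' hx' hs'
    rcases hinj x' hs' with h | h
    · exact h
    · subst h
      exact absurd hy hx'

end HeckeAction
end

noncomputable section

/-! ### The dimension of the 0-Hecke algebra -/

section Descending

variable {R : Type} [Ring R] (g : ℕ → R)

/-- The product `g k * g (k - 1) * ⋯` with `l` factors. -/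
def descProd (k : ℕ) : ℕ → R
  | 0 => 1
  | l + 1 => descProd k l * g (k - l)

variable {g} {N : ℕ}

theorem commute_descProd (hcomm : ∀ i j, i + 2 ≤ j → j < N → g i * g j = g j * g i)
    {k l i : ℕ} (hk : k < N) (hi : i + l < k) : g i * descProd g k l = descProd g k l * g i := by
  induction l with
  | zero => simp [descProd]
  | succ l ih =>
    rw [descProd, ← mul_assoc, ih (by omega), mul_assoc, hcomm i (k - l) (by omega) (by omega),
      mul_assoc]

theorem descProd_mul_of_gt (hcomm : ∀ i j, i + 2 ≤ j → j < N → g i * g j = g j * g i)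
    (hbraid : ∀ i, i + 1 < N → g i * g (i + 1) * g i = g (i + 1) * g i * g (i + 1))
    {k l i : ℕ} (hk : k < N) (hl : l ≤ k + 1) (hi : i ≤ k) (hil : k + 1 < i + l) :
    descProd g k l * g i = g (i - 1) * descProd g k l := by
  induction l with
  | zero => omega
  | succ l ih =>
    by_cases h : k + 1 < i + l
    · rw [descProd, mul_assoc, hcomm (k - l) i (by omega) (by omega), ← mul_assoc,
        ih (by omega) h, mul_assoc]
    · obtain ⟨l, rfl⟩ : ∃ l', l = l' + 1 := ⟨l - 1, by omega⟩
      obtain ⟨j, rfl⟩ : ∃ j, i = j + 1 := ⟨i - 1, by omega⟩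
      have e1 : k - l = j + 1 := by omega
      have e2 : k - (l + 1) = j := by omega
      rw [descProd, descProd, e1, e2, Nat.add_sub_cancel, ← mul_assoc, ← mul_assoc,
        commute_descProd hcomm hk (by omega), mul_assoc, mul_assoc, mul_assoc, mul_assoc]
      congr 1
      have := hbraid j (by omega)
      simp only [mul_assoc] at this
      rw [this]

variable [Algebra ℂ R] (g)

/-- The span of the normal forms in the first `k` generators: a normal form in one generator less,
times a product `g k * g (k - 1) * ⋯` with at most `k + 1` factors. -/
def normalSpan : ℕ → Submodule ℂ R
  | 0 => Submodule.span ℂ {1}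
  | k + 1 => ⨆ l : Fin (k + 2), (normalSpan k).map (LinearMap.mulRight ℂ (descProd g k l))

theorem normalSpan_zero : normalSpan g 0 = Submodule.span ℂ {1} := rfl

theorem normalSpan_succ (k : ℕ) : normalSpan g (k + 1) =
    ⨆ l : Fin (k + 2), (normalSpan g k).map (LinearMap.mulRight ℂ (descProd g k l)) := rfl

theorem one_mem_normalSpan (k : ℕ) : (1 : R) ∈ normalSpan g k := by
  induction k with
  | zero => exact Submodule.subset_span rfl
  | succ k ih =>
    refine Submodule.mem_iSup_of_mem (0 : Fin (k + 2)) ?_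
    exact ⟨1, ih, by simp [descProd]⟩

theorem finite_normalSpan (k : ℕ) : Module.Finite ℂ (normalSpan g k) := by
  induction k with
  | zero =>
    rw [normalSpan_zero]
    infer_instance
  | succ k ih =>
    rw [normalSpan_succ]
    infer_instance

theorem finrank_iSup_le {ι V : Type} [Fintype ι] [AddCommGroup V] [Module ℂ V]
    (p : ι → Submodule ℂ V) [∀ i, Module.Finite ℂ (p i)] {d : ℕ}
    (h : ∀ i, Module.finrank ℂ (p i) ≤ d) :
    Module.finrank ℂ (⨆ i, p i : Submodule ℂ V) ≤ Fintype.card ι * d := by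
  classical
  rw [← Finset.sup_univ_eq_iSup, ← Finset.card_univ]
  induction (Finset.univ : Finset ι) using Finset.induction_on with
  | empty => simp
  | insert a s ha ih =>
    rw [Finset.sup_insert, Finset.card_insert_of_notMem ha]
    change Module.finrank ℂ (s.sup p : Submodule ℂ V) ≤ _ at ih
    change Module.finrank ℂ (p a ⊔ s.sup p : Submodule ℂ V) ≤ _
    have : Module.Finite ℂ (s.sup p : Submodule ℂ V) := Submodule.finite_finset_sup s p
    have h1 := Submodule.finrank_add_le_finrank_add_finrank (p a) (s.sup p)
    have h2 := h a
    have h3 : (s.card + 1) * d = s.card * d + d := by ring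
    omega

theorem finrank_normalSpan_le (k : ℕ) : Module.finrank ℂ (normalSpan g k) ≤ (k + 1).factorial := by
  induction k with
  | zero =>
    rw [normalSpan_zero]
    exact (finrank_span_le_card (R := ℂ) ({1} : Set R)).trans (by simp)
  | succ k ih =>
    have := finite_normalSpan g k
    have h := finrank_iSup_le
      (fun l : Fin (k + 2) => (normalSpan g k).map (LinearMap.mulRight ℂ (descProd g k l)))
      (fun l => (Submodule.finrank_map_le _ _).trans ih)
    rw [Nat.factorial_succ (k + 1), normalSpan_succ]
    exact h.trans (by simp)

variable {g}

/-- The span of the normal forms is closed under right multiplication with generators. -/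
theorem mul_mem_normalSpan (hidem : ∀ i < N, g i * g i = g i)
    (hcomm : ∀ i j, i + 2 ≤ j → j < N → g i * g j = g j * g i)
    (hbraid : ∀ i, i + 1 < N → g i * g (i + 1) * g i = g (i + 1) * g i * g (i + 1))
    {k : ℕ} (hk : k ≤ N) {i : ℕ} (hi : i < k) {x : R} (hx : x ∈ normalSpan g k) :
    x * g i ∈ normalSpan g k := by
  induction k generalizing i x with
  | zero => omega
  | succ k ih =>
    have hmem : ∀ l < k + 2, ∀ y ∈ normalSpan g k, y * descProd g k l ∈ normalSpan g (k + 1) :=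
      fun l hl y hy => Submodule.mem_iSup_of_mem (⟨l, hl⟩ : Fin (k + 2)) ⟨y, hy, rfl⟩
    have hle : normalSpan g (k + 1) ≤
        (normalSpan g (k + 1)).comap (LinearMap.mulRight ℂ (g i)) := by
      refine iSup_le fun l => ?_
      rintro _ ⟨y, hy, rfl⟩
      obtain ⟨l, hl⟩ := l
      simp only [Submodule.mem_comap, LinearMap.mulRight_apply]
      rw [mul_assoc]
      rcases lt_trichotomy (i + l) k with h | h | h
      · rw [← commute_descProd hcomm (by omega) h, ← mul_assoc]
        exact hmem l hl _ (ih (by omega) (by omega) hy)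
      · have : descProd g k l * g i = descProd g k (l + 1) := by
          rw [descProd, ← h, Nat.add_sub_cancel]
        rw [this]
        exact hmem (l + 1) (by omega) _ hy
      · rcases Nat.lt_or_ge (k + 1) (i + l) with h' | h'
        · rw [descProd_mul_of_gt hcomm hbraid (by omega) (by omega) (by omega) h', ← mul_assoc]
          exact hmem l hl _ (ih (by omega) (by omega) hy)
        · obtain ⟨l, rfl⟩ : ∃ l', l = l' + 1 := ⟨l - 1, by omega⟩
          have e : k - l = i := by omega
          have : descProd g k (l + 1) * g i = descProd g k (l + 1) := by
            rw [descProd, e, mul_assoc, hidem i (by omega)]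
          rw [this]
          exact hmem (l + 1) hl _ hy
    exact hle hx

end Descending

theorem heckePi_idem {n : ℕ} (i : Fin (n - 1)) :
    (heckePi i * heckePi i : ZeroHecke n) = heckePi i := by
  have := RingQuot.mkAlgHom_rel ℂ (HeckeRel.idem i)
  rw [map_mul] at this
  exact this

theorem heckePi_comm {n : ℕ} (i j : Fin (n - 1)) (h : i.1 + 2 ≤ j.1) :
    (heckePi i * heckePi j : ZeroHecke n) = heckePi j * heckePi i := by
  have := RingQuot.mkAlgHom_rel ℂ (HeckeRel.comm i j h)
  rw [map_mul, map_mul] at this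
  exact this

theorem heckePi_braid {n : ℕ} (i j : Fin (n - 1)) (h : i.1 + 1 = j.1) :
    (heckePi i * heckePi j * heckePi i : ZeroHecke n) = heckePi j * heckePi i * heckePi j := by
  have := RingQuot.mkAlgHom_rel ℂ (HeckeRel.braid i j h)
  rw [map_mul, map_mul, map_mul, map_mul] at this
  exact this

theorem exists_normalSpan_eq_top (n : ℕ) :
    ∃ g : ℕ → ZeroHecke n, normalSpan g (n - 1) = ⊤ := by
  let g : ℕ → ZeroHecke n := fun i => if h : i < n - 1 then heckePi ⟨i, h⟩ else 0
  have hg : ∀ i (h : i < n - 1), g i = heckePi ⟨i, h⟩ := fun i h => dif_pos h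
  have hmul : ∀ i < n - 1, ∀ x ∈ normalSpan g (n - 1), x * g i ∈ normalSpan g (n - 1) := by
    intro i hi x hx
    refine mul_mem_normalSpan ?_ ?_ ?_ le_rfl hi hx
    · intro i hi
      rw [hg i hi, heckePi_idem]
    · intro i j hij hj
      rw [hg j hj, hg i (by omega), heckePi_comm _ _ hij]
    · intro i hi
      rw [hg _ hi, hg i (by omega), heckePi_braid _ _ rfl]
  refine ⟨g, ?_⟩
  rw [eq_top_iff]
  intro h _
  have hh : h ∈ Algebra.adjoin ℂ (Set.range (heckePi : Fin (n - 1) → ZeroHecke n)) := by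
    rw [adjoin_range_heckePi]
    trivial
  have key : ∀ x ∈ normalSpan g (n - 1), x * h ∈ normalSpan g (n - 1) := by
    induction hh using Algebra.adjoin_induction with
    | mem y hy =>
      obtain ⟨i, rfl⟩ := hy
      intro x hx
      have := hmul i.1 i.2 x hx
      rwa [hg i.1 i.2] at this
    | algebraMap r =>
      intro x hx
      rw [← Algebra.commutes, ← Algebra.smul_def]
      exact Submodule.smul_mem _ r hx
    | add a b _ _ ha hb =>
      intro x hx
      rw [mul_add]
      exact Submodule.add_mem _ (ha trivial x hx) (hb trivial x hx)
    | mul a b _ _ ha hb =>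
      intro x hx
      rw [← mul_assoc]
      exact hb trivial _ (ha trivial x hx)
  simpa using key 1 (one_mem_normalSpan g _)

instance (n : ℕ) : Module.Finite ℂ (ZeroHecke n) := by
  obtain ⟨g, hg⟩ := exists_normalSpan_eq_top n
  have := finite_normalSpan g (n - 1)
  rw [hg] at this
  exact Module.Finite.equiv (Submodule.topEquiv : (⊤ : Submodule ℂ (ZeroHecke n)) ≃ₗ[ℂ] _)

theorem finrank_zeroHecke_le (n : ℕ) : Module.finrank ℂ (ZeroHecke n) ≤ n.factorial := by
  obtain ⟨g, hg⟩ := exists_normalSpan_eq_top n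
  have := finrank_normalSpan_le g (n - 1)
  rw [hg, finrank_top] at this
  rcases Nat.eq_zero_or_pos n with rfl | hn
  · simpa using this
  · rwa [Nat.sub_add_cancel hn] at this

end

noncomputable section

/-! ### Injective modules -/

theorem injective_of_retract {R Q I : Type} [Ring R] [AddCommGroup Q] [AddCommGroup I]
    [Module R Q] [Module R I] (hI : Module.Injective R I) (f : Q →ₗ[R] I) (g : I →ₗ[R] Q)
    (hgf : ∀ x, g (f x) = x) : Module.Injective R Q where
  out X Y _ _ _ _ j hj k := by
    obtain ⟨h, hh⟩ := hI.out j hj (f ∘ₗ k)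
    exact ⟨g ∘ₗ h, fun x => by simp [hh, hgf]⟩

/-- A quotient of an injective module by an injective submodule is injective, since the submodule
splits off. -/
theorem injective_of_exact {R K I Q : Type} [Ring R] [AddCommGroup K] [AddCommGroup I]
    [AddCommGroup Q] [Module R K] [Module R I] [Module R Q] (hK : Module.Injective R K)
    (hI : Module.Injective R I) (f : K →ₗ[R] I) (g : I →ₗ[R] Q) (hf : Function.Injective f)
    (hg : Function.Surjective g) (hgf : ∀ x, g (f x) = 0) (hex : ∀ y, g y = 0 → ∃ x, f x = y) :
    Module.Injective R Q := by
  obtain ⟨r, hr⟩ := hK.out f hf LinearMap.id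
  have hwd : LinearMap.ker g ≤ LinearMap.ker (LinearMap.id - f ∘ₗ r) := by
    intro y hy
    obtain ⟨x, rfl⟩ := hex y hy
    simp [hr]
  let e := g.quotKerEquivOfSurjective hg
  let σ : Q →ₗ[R] I := (LinearMap.ker g).liftQ _ hwd ∘ₗ e.symm.toLinearMap
  have hσ : ∀ y, σ (g y) = y - f (r y) := by
    intro y
    have : e.symm (g y) = (LinearMap.ker g).mkQ y := by
      rw [LinearEquiv.symm_apply_eq]
      rfl
    simp only [σ, LinearMap.comp_apply, LinearEquiv.coe_coe, this]
    simp
  refine injective_of_retract hI σ g fun x => ?_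
  obtain ⟨y, rfl⟩ := hg x
  rw [hσ, map_sub, hgf, sub_zero]

/-- A module `N` over a finite-dimensional algebra `H` that carries a linear functional whose
kernel contains no nonzero submodule embeds into the dual of `H`. If `dim H ≤ dim N`, it is
isomorphic to the dual of `H`, hence injective. -/
theorem injective_of_functional {H N : Type} [Ring H] [Algebra ℂ H] [Module.Finite ℂ H]
    [AddCommGroup N] [Module ℂ N] [Module H N] [IsScalarTower ℂ H N]
    (hdim : Module.finrank ℂ H ≤ Module.finrank ℂ N) (l : N →ₗ[ℂ] ℂ)
    (hl : ∀ W : Submodule H N, (∀ x ∈ W, l x = 0) → W = ⊥) : Module.Injective H N := by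
  let Φ : N →ₗ[ℂ] (H →ₗ[ℂ] ℂ) :=
    { toFun := fun x =>
        { toFun := fun h => l (h • x)
          map_add' := fun a b => by rw [add_smul, map_add]
          map_smul' := fun c a => by rw [smul_assoc, map_smul, RingHom.id_apply] }
      map_add' := fun x y => by
        ext h
        simp
      map_smul' := fun c x => by
        ext h
        change l (h • c • x) = c • l (h • x)
        rw [← map_smul, ← algebraMap_smul H c x, ← mul_smul, ← Algebra.commutes, mul_smul,
          algebraMap_smul] }
  have hΦ : ∀ x h, Φ x h = l (h • x) := fun _ _ => rfl
  have hinj : Function.Injective Φ := by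
    rw [← LinearMap.ker_eq_bot]
    let W : Submodule H N :=
      { carrier := {x | Φ x = 0}
        add_mem' := fun {a b} ha hb => by
          change Φ (a + b) = 0
          rw [map_add, show Φ a = 0 from ha, show Φ b = 0 from hb, add_zero]
        zero_mem' := map_zero Φ
        smul_mem' := fun c x hx => by
          ext h
          have := DFunLike.congr_fun hx (h * c)
          rw [hΦ] at this ⊢
          rw [← mul_smul, this]
          rfl }
    have hW : W = ⊥ := hl W fun x hx => by
      have := DFunLike.congr_fun (show Φ x = 0 from hx) 1
      simpa [hΦ] using this
    rw [eq_bot_iff]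
    intro x hx
    have : x ∈ W := hx
    rw [hW] at this
    exact this
  have : Module.Finite ℂ N := Module.Finite.of_injective Φ hinj
  have hsurj : Function.Surjective Φ := by
    refine (LinearMap.injective_iff_surjective_of_finrank_eq_finrank ?_).1 hinj
    refine le_antisymm (LinearMap.finrank_le_finrank_of_injective hinj) ?_
    rw [show Module.finrank ℂ (H →ₗ[ℂ] ℂ) = Module.finrank ℂ H from Subspace.dual_finrank_eq]
    exact hdim
  refine ⟨fun X Y _ _ _ _ j hj k => ?_⟩
  let _ : Module ℂ X := Module.compHom X (algebraMap ℂ H)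
  let _ : Module ℂ Y := Module.compHom Y (algebraMap ℂ H)
  have hX : ∀ (c : ℂ) (x : X), c • x = algebraMap ℂ H c • x := fun _ _ => rfl
  have hY : ∀ (c : ℂ) (x : Y), c • x = algebraMap ℂ H c • x := fun _ _ => rfl
  let j' : X →ₗ[ℂ] Y :=
    { toFun := j
      map_add' := j.map_add
      map_smul' := fun c x => by rw [hX, map_smul, hY, RingHom.id_apply] }
  let k' : X →ₗ[ℂ] N :=
    { toFun := k
      map_add' := k.map_add
      map_smul' := fun c x => by rw [hX, map_smul, algebraMap_smul, RingHom.id_apply] }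
  obtain ⟨q, hq⟩ := j'.exists_leftInverse_of_injective (LinearMap.ker_eq_bot.2 hj)
  have hq' : ∀ x, q (j x) = x := fun x => LinearMap.congr_fun hq x
  let m : Y →ₗ[ℂ] ℂ := l ∘ₗ k' ∘ₗ q
  have hm : ∀ x, m (j x) = l (k x) := fun x => by
    change l (k (q (j x))) = _
    rw [hq']
  let μ : Y → H →ₗ[ℂ] ℂ := fun y =>
    { toFun := fun h => m (h • y)
      map_add' := fun a b => by rw [add_smul, map_add]
      map_smul' := fun c a => by
        rw [Algebra.smul_def, mul_smul, ← hY, map_smul, RingHom.id_apply] }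
  choose t ht using fun y => hsurj (μ y)
  have ht' : ∀ y h, l (h • t y) = m (h • y) := fun y h => DFunLike.congr_fun (ht y) h
  refine ⟨{ toFun := t, map_add' := fun a b => hinj ?_, map_smul' := fun c a => hinj ?_ },
    fun x => hinj ?_⟩
  · ext h
    simp only [map_add, LinearMap.add_apply, hΦ, ht', smul_add]
  · ext h
    rw [hΦ, hΦ, ht', RingHom.id_apply, ← mul_smul, ← mul_smul, ht']
  · ext h
    change l (h • t (j x)) = l (h • k x)
    rw [ht', ← map_smul, hm, map_smul]

end

noncomputable section

/-! ### Subquotients of a partial action -/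

namespace HeckeAction

variable {n : ℕ} {X : Type} (A : HeckeAction n X)

/-- A property of basis elements that the action preserves. Its elements span a submodule. -/
def Stable (U : X → Prop) : Prop := ∀ i x y, A.s i x = some y → U x → U y

open Classical in
/-- The partial map from `X` to the set of the elements of `U` outside `V`. -/
def cut (U V : X → Prop) (x : X) : Option {x : X // U x ∧ ¬ V x} :=
  if h : U x ∧ ¬ V x then some ⟨x, h⟩ else none

theorem cut_eq_some {U V : X → Prop} {x : X} {y : {x : X // U x ∧ ¬ V x}} :
    cut U V x = some y ↔ x = y.1 := by
  unfold cut
  split_ifs with h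
  · simp [Subtype.ext_iff]
  · simp only [false_iff]
    rintro rfl
    exact h y.2

theorem cut_eq_none {U V : X → Prop} {x : X} (h : ¬ (U x ∧ ¬ V x)) : cut U V x = none :=
  dif_neg h

theorem cut_eq {U V : X → Prop} {x : X} (h : U x ∧ ¬ V x) : cut U V x = some ⟨x, h⟩ :=
  dif_pos h

variable {A}

/-- Cutting may be done before or after applying a generator, since an element of `V` stays in
`V`. -/
theorem cut_bind {U V : X → Prop} (hV : A.Stable V) (i : Fin (n - 1)) {x : X} (hx : U x) :
    (cut U V x).bind (fun z => (A.s i z.1).bind (cut U V)) = (A.s i x).bind (cut U V) := by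
  by_cases h : V x
  · rw [cut_eq_none (by simp [h])]
    cases hs : A.s i x with
    | none => rfl
    | some y => simp [cut_eq_none (U := U) (V := V) (x := y) (by simp [hV i x y hs h])]
  · rw [cut_eq ⟨hx, h⟩]
    rfl

theorem cut_bind_bind {U V : X → Prop} (hU : A.Stable U) (hV : A.Stable V) (i j : Fin (n - 1))
    {x : X} (hx : U x) :
    ((A.s i x).bind (cut U V)).bind (fun z => (A.s j z.1).bind (cut U V)) =
      ((A.s i x).bind (A.s j)).bind (cut U V) := by
  cases hs : A.s i x with
  | none => rfl
  | some y => exact cut_bind hV j (hU i x y hs hx)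

theorem cut_bind_bind_bind {U V : X → Prop} (hU : A.Stable U) (hV : A.Stable V)
    (i j k : Fin (n - 1)) {x : X} (hx : U x) :
    (((A.s i x).bind (cut U V)).bind (fun z => (A.s j z.1).bind (cut U V))).bind
      (fun z => (A.s k z.1).bind (cut U V)) =
      (((A.s i x).bind (A.s j)).bind (A.s k)).bind (cut U V) := by
  rw [cut_bind_bind hU hV i j hx]
  cases hs : A.s i x with
  | none => rfl
  | some y => exact cut_bind_bind hU hV j k (hU i x y hs hx)

variable (A)

/-- The action on the subquotient with basis the elements of `U` outside `V`: the quotient of the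
submodule spanned by `U` by the submodule spanned by the elements in both `U` and `V`. -/
def restrict (U V : X → Prop) (hU : A.Stable U) (hV : A.Stable V) :
    HeckeAction n {x : X // U x ∧ ¬ V x} where
  s i x := (A.s i x.1).bind (cut U V)
  idem i x := by
    rw [cut_bind_bind hU hV i i x.2.1, A.idem]
  braid i j h x := by
    rw [cut_bind_bind_bind hU hV i j i x.2.1, cut_bind_bind_bind hU hV j i j x.2.1, A.braid i j h]
  comm i j h x := by
    rw [cut_bind_bind hU hV j i x.2.1, cut_bind_bind hU hV i j x.2.1, A.comm i j h]

variable {A}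

/-- The canonical homomorphism between subquotients. -/
def cutHom {U V U' V' : X → Prop} (hU : A.Stable U) (hV : A.Stable V) (hU' : A.Stable U')
    (hV' : A.Stable V') (h1 : ∀ x, U x → U' x) (h2 : ∀ x, V x → V' x) :
    (A.restrict U V hU hV).Mod →ₗ[ZeroHecke n] (A.restrict U' V' hU' hV').Mod :=
  HeckeAction.hom _ _ (fun x => cut U' V' x.1) (by
    intro i x
    refine Eq.trans ?_ (cut_bind hV' i (h1 _ x.2.1)).symm
    change ((A.s i x.1).bind (cut U V)).bind _ = _
    cases hs : A.s i x.1 with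
    | none => rfl
    | some y =>
      by_cases h : V y
      · simp [cut_eq_none (U := U) (V := V) (x := y) (by simp [h]),
          cut_eq_none (U := U') (V := V') (x := y) (by simp [h2 _ h])]
      · simp [cut_eq (U := U) (V := V) (x := y) ⟨hU i _ y hs x.2.1, h⟩])

/-- The subquotient attached to `U` and `V` is an injective `H_n(0)`-module. -/
def InjectiveCut (A : HeckeAction n X) (U V : X → Prop) : Prop :=
  ∀ (hU : A.Stable U) (hV : A.Stable V),
    Module.Injective (ZeroHecke n) (A.restrict U V hU hV).Mod

/-- The subquotient attached to `U ∧ E` and `V` embeds into that attached to `U` and `V`, with the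
subquotient attached to `U` and `V ∨ E` as cokernel. -/
theorem injectiveCut_or {U V E : X → Prop} (hU : A.Stable U) (hV : A.Stable V) (hE : A.Stable E)
    (h1 : A.InjectiveCut U V) (h2 : A.InjectiveCut (fun x => U x ∧ E x) V) :
    A.InjectiveCut U (fun x => V x ∨ E x) := by
  intro _ hVE
  have hUE : A.Stable (fun x => U x ∧ E x) := fun i x y hs h =>
    ⟨hU i x y hs h.1, hE i x y hs h.2⟩
  let B := A.restrict (fun x => U x ∧ E x) V hUE hV
  let C := A.restrict U V hU hV
  let Q := A.restrict U (fun x => V x ∨ E x) hU hVE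
  let f : B.Mod →ₗ[ZeroHecke n] C.Mod := cutHom hUE hV hU hV (fun x h => h.1) (fun x h => h)
  let g : C.Mod →ₗ[ZeroHecke n] Q.Mod := cutHom hU hV hU hVE (fun x h => h) (fun x h => Or.inl h)
  have hf : ∀ v (x : {x // (U x ∧ E x) ∧ ¬ V x}) (y : {x // U x ∧ ¬ V x}), x.1 = y.1 →
      C.coeff (f v) y = B.coeff v x := by
    intro v x y hxy
    refine partialLin_apply_of_unique _ _ ?_ fun x' _ hx' => ?_
    · exact cut_eq_some.2 hxy
    · exact Subtype.ext ((cut_eq_some.1 hx').trans hxy.symm)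
  have hf0 : ∀ v (y : {x // U x ∧ ¬ V x}), ¬ E y.1 → C.coeff (f v) y = 0 := by
    intro v y hy
    refine partialLin_apply_eq_zero _ _ fun x _ hx => hy ?_
    rw [← cut_eq_some.1 hx]
    exact x.2.1.2
  have hg : ∀ v (x : {x // U x ∧ ¬ V x}) (y : {x // U x ∧ ¬ (V x ∨ E x)}), x.1 = y.1 →
      Q.coeff (g v) y = C.coeff v x := by
    intro v x y hxy
    refine partialLin_apply_of_unique _ _ ?_ fun x' _ hx' => ?_
    · exact cut_eq_some.2 hxy
    · exact Subtype.ext ((cut_eq_some.1 hx').trans hxy.symm)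
  refine injective_of_exact (h2 hUE hV) (h1 hU hV) f g ?_ ?_ ?_ ?_
  · intro v w hvw
    apply B.coeff.injective
    ext x
    rw [← hf v x ⟨x.1, x.2.1.1, x.2.2⟩ rfl, ← hf w x ⟨x.1, x.2.1.1, x.2.2⟩ rfl, hvw]
  · intro v
    refine ⟨C.coeff.symm ((Q.coeff v).mapDomain fun y =>
      (⟨y.1, y.2.1, fun h => y.2.2 (Or.inl h)⟩ : {x // U x ∧ ¬ V x})), ?_⟩
    apply Q.coeff.injective
    ext y
    rw [hg _ ⟨y.1, y.2.1, fun h => y.2.2 (Or.inl h)⟩ y rfl, LinearEquiv.apply_symm_apply]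
    refine Finsupp.mapDomain_apply (f := fun y : {x // U x ∧ ¬ (V x ∨ E x)} =>
      (⟨y.1, y.2.1, fun h => y.2.2 (Or.inl h)⟩ : {x // U x ∧ ¬ V x})) ?_ _ y
    intro a b hab
    have := congrArg Subtype.val hab
    exact Subtype.ext this
  · intro v
    apply Q.coeff.injective
    ext y
    rw [hg _ ⟨y.1, y.2.1, fun h => y.2.2 (Or.inl h)⟩ y rfl,
      hf0 _ _ (fun h => y.2.2 (Or.inr h))]
    simp
  · intro v hv
    have hinj : Function.Injective (fun x : {x // (U x ∧ E x) ∧ ¬ V x} =>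
        (⟨x.1, x.2.1.1, x.2.2⟩ : {x // U x ∧ ¬ V x})) := fun a b hab => by
      have := congrArg Subtype.val hab
      exact Subtype.ext this
    refine ⟨B.coeff.symm ((C.coeff v).comapDomain _ hinj.injOn), ?_⟩
    apply C.coeff.injective
    ext y
    by_cases hy : E y.1
    · rw [hf _ ⟨y.1, ⟨y.2.1, hy⟩, y.2.2⟩ y rfl, LinearEquiv.apply_symm_apply,
        Finsupp.comapDomain_apply]
    · rw [hf0 _ _ hy, ← hg v y ⟨y.1, y.2.1, not_or.2 ⟨y.2.2, hy⟩⟩ rfl, hv]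
      simp

end HeckeAction

end

noncomputable section

/-! ### The regular module, realized on arbitrary fillings -/

/-- Exchanging two values that are ordered like the weights at their places lowers the weighted
sum. -/
theorem sum_swap_mul_lt {ι : Type} [Fintype ι] [DecidableEq ι] (f g : ι → ℕ) {a b : ι}
    (hf : f a < f b) (hg : g a < g b) :
    ∑ x, f (Equiv.swap a b x) * g x < ∑ x, f x * g x := by
  have hab : a ≠ b := by
    rintro rfl
    exact lt_irrefl _ hf
  rw [← Finset.sum_add_sum_compl {a, b}, ← Finset.sum_add_sum_compl {a, b} (fun x => f x * g x),
    Finset.sum_pair hab, Finset.sum_pair hab, Equiv.swap_apply_left, Equiv.swap_apply_right]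
  have : ∑ x ∈ ({a, b} : Finset ι)ᶜ, f (Equiv.swap a b x) * g x =
      ∑ x ∈ ({a, b} : Finset ι)ᶜ, f x * g x := by
    refine Finset.sum_congr rfl fun x hx => ?_
    simp only [Finset.mem_compl, Finset.mem_insert, Finset.mem_singleton, not_or] at hx
    rw [Equiv.swap_apply_of_ne_of_ne hx.1 hx.2]
  rw [this]
  have : f b * g a + f a * g b < f a * g a + f b * g b := by nlinarith
  omega

/-- The number of the antidiagonal of a cell. It increases towards the north-east. -/
def key (b : ℕ × ℕ) : ℕ := b.1 + b.2

variable {D : Finset (ℕ × ℕ)} {n : ℕ}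

theorem lo_ne_hi (i : Fin (n - 1)) : lo i ≠ hi i := by simp [lo, hi, Fin.ext_iff]

theorem lo_lt_hi (i : Fin (n - 1)) : lo i < hi i := by simp [lo, hi, Fin.lt_def]

namespace Filling

theorem swap_swap (F : Filling D n) (i : Fin (n - 1)) : (F.swap i).swap i = F := by
  ext b
  simp [Filling.swap]

theorem pos_swap_lo (F : Filling D n) (i : Fin (n - 1)) : (F.swap i).pos (lo i) = F.pos (hi i) := by
  rw [Filling.pos_swap, Equiv.swap_apply_left]

theorem pos_swap_hi (F : Filling D n) (i : Fin (n - 1)) : (F.swap i).pos (hi i) = F.pos (lo i) := by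
  rw [Filling.pos_swap, Equiv.swap_apply_right]

theorem pos_mem (F : Filling D n) (k : Fin n) : F.pos k ∈ D := (F.symm k).2

theorem pos_injective (F : Filling D n) : Function.Injective F.pos := fun _ _ h =>
  F.symm.injective (Subtype.ext h)

/-- A measure of the noninversions of a filling. -/
def rank (F : Filling D n) : ℕ := ∑ k : Fin n, key (F.pos k) * k.1

theorem rank_swap_lt (F : Filling D n) (i : Fin (n - 1))
    (h : key (F.pos (lo i)) < key (F.pos (hi i))) : (F.swap i).rank < F.rank := by
  unfold rank
  simp only [Filling.pos_swap]
  exact sum_swap_mul_lt (fun k => key (F.pos k)) (fun k => k.1) h (lo_lt_hi i)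

/-- The action of `π_i` on a filling that is regarded as a word, read along the antidiagonals: if
`i` precedes `i + 1`, they are exchanged. -/
def move (i : Fin (n - 1)) (F : Filling D n) : Filling D n :=
  if key (F.pos (lo i)) < key (F.pos (hi i)) then F.swap i else F

theorem fillingAct_eq_move (i : Fin (n - 1)) (F : Filling D n) :
    fillingAct (fun p q => decide (key p < key q)) (fun _ _ => false) i F = some (F.move i) := by
  simp only [fillingAct, move, decide_eq_true_eq, Bool.false_eq_true, if_false]
  split_ifs <;> rfl

end Filling

variable (D n) in
/-- The left regular action of the 0-Hecke generators, on the fillings of `D` regarded as words. -/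
def wordAction : HeckeAction n (Filling D n) where
  s i F := some (F.move i)
  idem i F := by
    simp only [← Filling.fillingAct_eq_move]
    apply fillingAct_idem
    simp
    omega
  braid i j h F := by
    simp only [← Filling.fillingAct_eq_move]
    apply fillingAct_braid _ _ _ _ _ i j h
    all_goals simp
    all_goals omega
  comm i j h F := by
    simp only [← Filling.fillingAct_eq_move]
    exact fillingAct_comm _ _ i j h F

theorem wordAction_eq_some {i : Fin (n - 1)} {F G : Filling D n} :
    (wordAction D n).s i F = some G ↔ F.move i = G := by
  simp [wordAction]

/-- A word with decreasing letters is unique. -/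
theorem eq_of_decreasing (hD : Set.InjOn key (D : Set (ℕ × ℕ))) {F G : Filling D n}
    (hF : ∀ i : Fin (n - 1), ¬ key (F.pos (lo i)) < key (F.pos (hi i)))
    (hG : ∀ i : Fin (n - 1), ¬ key (G.pos (lo i)) < key (G.pos (hi i))) : F = G := by
  have hanti : ∀ H : Filling D n, (∀ i : Fin (n - 1), ¬ key (H.pos (lo i)) < key (H.pos (hi i))) →
      StrictMono fun k : Fin n => OrderDual.toDual (key (H.pos k)) := by
    intro H hH
    cases n with
    | zero => exact fun a => a.elim0
    | succ m =>
      rw [Fin.strictMono_iff_lt_succ]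
      intro i
      rw [OrderDual.toDual_lt_toDual]
      refine lt_of_le_of_ne (not_lt.1 (hH i)) fun h => ?_
      exact lo_ne_hi (n := m + 1) i (H.pos_injective (hD (H.pos_mem _) (H.pos_mem _) h)).symm
  have hrange : ∀ H : Filling D n, Set.range (fun k : Fin n => OrderDual.toDual (key (H.pos k))) =
      (fun b => OrderDual.toDual (key b)) '' (D : Set (ℕ × ℕ)) := by
    intro H
    ext x
    constructor
    · rintro ⟨k, rfl⟩
      exact ⟨_, H.pos_mem k, rfl⟩
    · rintro ⟨b, hb, rfl⟩
      exact ⟨H ⟨b, hb⟩, by simp only [Filling.pos_apply]⟩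
  have heq := (StrictMono.range_inj (hanti F hF) (hanti G hG)).1 ((hrange F).trans (hrange G).symm)
  have : F.symm = G.symm := by
    ext1 k
    exact Subtype.ext (hD (F.pos_mem k) (G.pos_mem k) (OrderDual.toDual.injective (congrFun heq k)))
  rw [← Equiv.symm_symm F, this, Equiv.symm_symm]

theorem wordAction_rank (i : Fin (n - 1)) (F G : Filling D n)
    (h : (wordAction D n).s i F = some G) : G = F ∨ G.rank < F.rank := by
  rw [wordAction_eq_some] at h
  subst h
  unfold Filling.move
  split_ifs with hlt
  · exact Or.inr (F.rank_swap_lt i hlt)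
  · exact Or.inl rfl

/-- The support of an eigenvector contains the decreasing word. -/
theorem exists_decreasing_mem_support {v : (wordAction D n).Mod} (hv0 : v ≠ 0)
    (hv : ∀ i : Fin (n - 1), (heckePi i : ZeroHecke n) • v = v ∨
      (heckePi i : ZeroHecke n) • v = 0) :
    ∃ F, (wordAction D n).coeff v F ≠ 0 ∧
      ∀ i : Fin (n - 1), ¬ key (F.pos (lo i)) < key (F.pos (hi i)) := by
  obtain ⟨F₀, hF₀⟩ := Finsupp.ne_iff.1 ((map_ne_zero_iff _ (wordAction D n).coeff.injective).2 hv0)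
  obtain ⟨F, hF, hmin⟩ := (measure (Filling.rank (D := D) (n := n))).wf.has_min
    {F | (wordAction D n).coeff v F ≠ 0} ⟨F₀, hF₀⟩
  refine ⟨F, hF, fun i hlt => hmin (F.swap i) ?_ (F.rank_swap_lt i hlt)⟩
  have hmove : F.move i = F.swap i := if_pos hlt
  refine (wordAction D n).coeff_ne_zero_of_moved (hv i) hF (wordAction_eq_some.2 hmove) ?_ ?_
  · intro h
    have := F.rank_swap_lt i hlt
    rw [h] at this
    exact lt_irrefl _ this
  · intro G hG
    rw [wordAction_eq_some] at hG
    unfold Filling.move at hG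
    split_ifs at hG
    · left
      rw [← G.swap_swap i, hG, F.swap_swap]
    · exact Or.inr hG

/-- The regular module is injective. The functional which takes the coefficient of the decreasing
word vanishes on no nonzero submodule. -/
theorem injective_wordAction (hD : Set.InjOn key (D : Set (ℕ × ℕ))) (hcard : D.card = n) :
    Module.Injective (ZeroHecke n) (wordAction D n).Mod := by
  have hdim : Module.finrank ℂ (ZeroHecke n) ≤ Module.finrank ℂ (wordAction D n).Mod := by
    have e : Filling D n := D.equivFinOfCardEq hcard
    rw [(wordAction D n).coeff.finrank_eq, Module.finrank_finsupp_self, Fintype.card_equiv e,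
      Fintype.card_coe, hcard]
    exact finrank_zeroHecke_le n
  by_cases hex : ∃ F : Filling D n, ∀ i : Fin (n - 1), ¬ key (F.pos (lo i)) < key (F.pos (hi i))
  · obtain ⟨F, hF⟩ := hex
    refine injective_of_functional hdim
      (Finsupp.lapply F ∘ₗ (wordAction D n).coeff.toLinearMap) fun W hW => ?_
    by_contra hne
    obtain ⟨v, hvW, hv0, hv⟩ :=
      (wordAction D n).exists_eigenvector Filling.rank wordAction_rank W hne
    obtain ⟨G, hG, hG'⟩ := exists_decreasing_mem_support hv0 hv
    rw [eq_of_decreasing hD hG' hF] at hG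
    exact hG (hW v hvW)
  · refine injective_of_functional hdim 0 fun W hW => ?_
    by_contra hne
    obtain ⟨v, hvW, hv0, hv⟩ :=
      (wordAction D n).exists_eigenvector Filling.rank wordAction_rank W hne
    obtain ⟨G, _, hG⟩ := exists_decreasing_mem_support hv0 hv
    exact hex ⟨G, hG⟩

end

noncomputable section

/-! ### Sorting words -/

variable {D : Finset (ℕ × ℕ)} {n : ℕ}

/-- Two cells that are consecutive in the order given by `key`. -/
def Consecutive (p : {b // b ∈ D} × {b // b ∈ D}) : Prop :=
  key p.1.1 < key p.2.1 ∧ ∀ w ∈ D, key w ≤ key p.1.1 ∨ key p.2.1 ≤ key w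

/-- Exchanging two consecutive cells does not change the order of any other pair of cells. -/
theorem key_swap_lt_iff (hD : Set.InjOn key (D : Set (ℕ × ℕ)))
    {p : {b // b ∈ D} × {b // b ∈ D}} (hp : Consecutive p) {a b : {b // b ∈ D}} (hab : a ≠ b)
    (h1 : ¬ (a = p.1 ∧ b = p.2)) (h2 : ¬ (a = p.2 ∧ b = p.1)) :
    key (Equiv.swap p.1 p.2 a).1 < key (Equiv.swap p.1 p.2 b).1 ↔ key a.1 < key b.1 := by
  obtain ⟨u, v⟩ := p
  obtain ⟨huv, hbetween⟩ := hp
  simp only at huv hbetween h1 h2 ⊢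
  have hne : ∀ x y : {b // b ∈ D}, x ≠ y → key x.1 ≠ key y.1 := fun x y hxy h =>
    hxy (Subtype.ext (hD x.2 y.2 h))
  have hwa := hbetween a.1 a.2
  have hwb := hbetween b.1 b.2
  by_cases au : a = u
  · have bu : b ≠ u := fun h => hab (au.trans h.symm)
    have bv : b ≠ v := fun h => h1 ⟨au, h⟩
    have n1 := hne b u bu
    have n2 := hne b v bv
    rw [Equiv.swap_apply_of_ne_of_ne bu bv, au, Equiv.swap_apply_left]
    omega
  by_cases av : a = v
  · have bu : b ≠ u := fun h => h2 ⟨av, h⟩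
    have bv : b ≠ v := fun h => hab (av.trans h.symm)
    have n1 := hne b u bu
    have n2 := hne b v bv
    rw [Equiv.swap_apply_of_ne_of_ne bu bv, av, Equiv.swap_apply_right]
    omega
  rw [Equiv.swap_apply_of_ne_of_ne au av]
  have n1 := hne a u au
  have n2 := hne a v av
  by_cases bu : b = u
  · rw [bu, Equiv.swap_apply_left]
    omega
  by_cases bv : b = v
  · rw [bv, Equiv.swap_apply_right]
    omega
  rw [Equiv.swap_apply_of_ne_of_ne bu bv]

namespace Filling

/-- The right action of a 0-Hecke generator on words: the letters at two consecutive places are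
brought into decreasing order. -/
def sortStep (p : {b // b ∈ D} × {b // b ∈ D}) (F : Filling D n) : Filling D n :=
  if F p.1 < F p.2 then (Equiv.swap p.1 p.2).trans F else F

/-- The right action commutes with the left action. -/
theorem sortStep_move (hD : Set.InjOn key (D : Set (ℕ × ℕ))) {p : {b // b ∈ D} × {b // b ∈ D}}
    (hp : Consecutive p) (i : Fin (n - 1)) (F : Filling D n) :
    sortStep p (F.move i) = (sortStep p F).move i := by
  obtain ⟨u, v⟩ := p
  obtain ⟨huv, hbetween⟩ := hp
  simp only at huv hbetween
  have hlh := lo_lt_hi i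
  obtain ⟨a, ha⟩ : ∃ a, F a = lo i := ⟨F.symm (lo i), by simp⟩
  obtain ⟨b, hb⟩ : ∃ b, F b = hi i := ⟨F.symm (hi i), by simp⟩
  have hab : a ≠ b := by
    rintro rfl
    exact lo_ne_hi i (ha.symm.trans hb)
  have hFa : F.pos (lo i) = a.1 := by rw [← ha, Filling.pos_apply]
  have hFb : F.pos (hi i) = b.1 := by rw [← hb, Filling.pos_apply]
  let G : Filling D n := (Equiv.swap u v).trans F
  have hGa : G.pos (lo i) = (Equiv.swap u v a).1 := by
    rw [← Filling.pos_apply G (Equiv.swap u v a)]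
    simp [G, ha]
  have hGb : G.pos (hi i) = (Equiv.swap u v b).1 := by
    rw [← Filling.pos_apply G (Equiv.swap u v b)]
    simp [G, hb]
  have huv' : u ≠ v := by
    rintro rfl
    exact lt_irrefl _ huv
  by_cases h1 : a = u ∧ b = v
  · obtain ⟨rfl, rfl⟩ := h1
    have hFs : F.swap i = G := by
      change F.trans (Equiv.swap (lo i) (hi i)) = (Equiv.swap a b).trans F
      rw [← ha, ← hb]
      ext x
      simp [Equiv.swap_apply_def, apply_ite F]
    have e1 : F.move i = G := by
      rw [move, hFa, hFb, if_pos huv, hFs]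
    have e2 : sortStep (a, b) F = G := by
      rw [sortStep, if_pos]
      simpa [ha, hb] using hlh
    have e3 : G.move i = G := by
      rw [move, hGa, hGb, if_neg]
      simp only [Equiv.swap_apply_left, Equiv.swap_apply_right]
      omega
    have e4 : sortStep (a, b) G = G := by
      rw [sortStep, if_neg]
      simp only [G, Equiv.trans_apply, Equiv.swap_apply_left, Equiv.swap_apply_right, ha, hb]
      exact not_lt.2 hlh.le
    rw [e1, e2, e3, e4]
  by_cases h2 : a = v ∧ b = u
  · obtain ⟨rfl, rfl⟩ := h2
    have e1 : F.move i = F := by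
      rw [move, hFa, hFb, if_neg (by omega)]
    have e2 : sortStep (b, a) F = F := by
      rw [sortStep, if_neg]
      simpa [ha, hb] using hlh.le
    rw [e1, e2, e1]
  have hval : (F.swap i) u < (F.swap i) v ↔ F u < F v := by
    have hFs : ∀ x, (F.swap i) x = Equiv.swap (lo i) (hi i) (F x) := fun x => rfl
    rw [hFs, hFs]
    constructor
    · intro h
      by_contra hlt
      have h' : F v < F u := lt_of_le_of_ne (not_lt.1 hlt) fun e => huv' (F.injective e).symm
      refine lt_asymm h (swap_lt_swap i h' ?_)
      rintro ⟨e1, e2⟩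
      exact h2 ⟨F.injective (ha.trans e1.symm), F.injective (hb.trans e2.symm)⟩
    · intro h
      refine swap_lt_swap i h ?_
      rintro ⟨e1, e2⟩
      exact h1 ⟨F.injective (ha.trans e1.symm), F.injective (hb.trans e2.symm)⟩
  have hpos : key (Equiv.swap u v a).1 < key (Equiv.swap u v b).1 ↔ key a.1 < key b.1 := by
    exact key_swap_lt_iff (p := (u, v)) hD ⟨huv, hbetween⟩ hab h1 h2
  have hGs : G.swap i = (Equiv.swap u v).trans (F.swap i) := rfl
  by_cases hu : F u < F v <;> by_cases hk : key a.1 < key b.1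
  · rw [show F.move i = F.swap i by rw [move, hFa, hFb, if_pos hk],
      show sortStep (u, v) F = G from if_pos hu,
      show G.move i = G.swap i by rw [move, hGa, hGb, if_pos (hpos.2 hk)], hGs]
    exact if_pos (hval.2 hu)
  · rw [show F.move i = F by rw [move, hFa, hFb, if_neg hk],
      show sortStep (u, v) F = G from if_pos hu,
      show G.move i = G by rw [move, hGa, hGb, if_neg (fun h => hk (hpos.1 h))]]
  · rw [show F.move i = F.swap i by rw [move, hFa, hFb, if_pos hk],
      show sortStep (u, v) F = F from if_neg hu,
      show F.move i = F.swap i by rw [move, hFa, hFb, if_pos hk]]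
    exact if_neg (fun h => hu (hval.1 h))
  · rw [show F.move i = F by rw [move, hFa, hFb, if_neg hk],
      show sortStep (u, v) F = F from if_neg hu,
      show F.move i = F by rw [move, hFa, hFb, if_neg hk]]

/-- A measure of the noninversions of a word, in terms of its letters. -/
def letterRank (F : Filling D n) : ℕ := ∑ b : {b // b ∈ D}, (F b).1 * key b.1

theorem letterRank_sortStep {p : {b // b ∈ D} × {b // b ∈ D}} (hp : key p.1.1 < key p.2.1)
    (F : Filling D n) :
    (sortStep p F = F ∧ ¬ F p.1 < F p.2) ∨ (sortStep p F).letterRank < F.letterRank := by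
  by_cases h : F p.1 < F p.2
  · right
    rw [sortStep, if_pos h]
    exact sum_swap_mul_lt (fun b => (F b).1) (fun b : {b // b ∈ D} => key b.1) h hp
  · exact Or.inl ⟨if_neg h, h⟩

/-- All sorting steps of a list, one after the other. -/
def sortSteps (L : List ({b // b ∈ D} × {b // b ∈ D})) (F : Filling D n) : Filling D n :=
  L.foldr sortStep F

theorem sortSteps_move (hD : Set.InjOn key (D : Set (ℕ × ℕ)))
    {L : List ({b // b ∈ D} × {b // b ∈ D})} (hL : ∀ p ∈ L, Consecutive p) (i : Fin (n - 1))
    (F : Filling D n) : sortSteps L (F.move i) = (sortSteps L F).move i := by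
  induction L with
  | nil => rfl
  | cons p L ih =>
    rw [List.forall_mem_cons] at hL
    change sortStep p (sortSteps L (F.move i)) = (sortStep p (sortSteps L F)).move i
    rw [ih hL.2, sortStep_move hD hL.1]

theorem letterRank_sortSteps {L : List ({b // b ∈ D} × {b // b ∈ D})}
    (hL : ∀ p ∈ L, key p.1.1 < key p.2.1) (F : Filling D n) :
    (sortSteps L F = F ∧ ∀ p ∈ L, ¬ F p.1 < F p.2) ∨
      (sortSteps L F).letterRank < F.letterRank := by
  induction L with
  | nil => exact Or.inl ⟨rfl, by simp⟩
  | cons p L ih =>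
    rw [List.forall_mem_cons] at hL
    change (sortStep p (sortSteps L F) = F ∧ _) ∨ (sortStep p (sortSteps L F)).letterRank < _
    have h := letterRank_sortStep hL.1 (sortSteps L F)
    rcases ih hL.2 with ⟨h1, h2⟩ | h1
    · rw [h1] at h ⊢
      rcases h with h | h
      · exact Or.inl ⟨h.1, List.forall_mem_cons.2 ⟨h.2, h2⟩⟩
      · exact Or.inr h
    · rcases h with h | h
      · rw [h.1]
        exact Or.inr h1
      · exact Or.inr (h.trans h1)

theorem sortSteps_eq_self {L : List ({b // b ∈ D} × {b // b ∈ D})} {F : Filling D n}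
    (h : ∀ p ∈ L, ¬ F p.1 < F p.2) : sortSteps L F = F := by
  induction L with
  | nil => rfl
  | cons p L ih =>
    rw [List.forall_mem_cons] at h
    change sortStep p (sortSteps L F) = F
    rw [ih h.2]
    exact if_neg h.1

/-- A word is sorted after as many repetitions as its rank allows. -/
theorem iterate_sortSteps {L : List ({b // b ∈ D} × {b // b ∈ D})}
    (hL : ∀ p ∈ L, key p.1.1 < key p.2.1) (k : ℕ) (F : Filling D n) (hk : F.letterRank < k) :
    ∀ p ∈ L, ¬ ((sortSteps L)^[k] F) p.1 < ((sortSteps L)^[k] F) p.2 := by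
  induction k generalizing F with
  | zero => omega
  | succ k ih =>
    rw [Function.iterate_succ_apply]
    rcases letterRank_sortSteps hL F with h | h
    · rw [Function.iterate_fixed (h.1.symm ▸ h.1)]
      · rw [h.1]
        exact h.2
    · exact ih _ (by omega)

/-- The word descends at the given pairs of places. -/
def Descends (L : List ({b // b ∈ D} × {b // b ∈ D})) (F : Filling D n) : Prop :=
  ∀ p ∈ L, F p.2 < F p.1

theorem descends_iff {L : List ({b // b ∈ D} × {b // b ∈ D})}
    (hL : ∀ p ∈ L, key p.1.1 < key p.2.1) (F : Filling D n) :
    F.Descends L ↔ ∀ p ∈ L, ¬ F p.1 < F p.2 := by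
  refine forall₂_congr fun p hp => ?_
  rw [not_lt]
  refine ⟨le_of_lt, fun h => lt_of_le_of_ne h fun e => ?_⟩
  have := hL p hp
  rw [F.injective e] at this
  exact lt_irrefl _ this

/-- The word descends at one of the given pairs of places. -/
def SomeDescent (L : List ({b // b ∈ D} × {b // b ∈ D})) (F : Filling D n) : Prop :=
  ∃ p ∈ L, F p.2 < F p.1

end Filling

open Filling HeckeAction

theorem stable_descent {p : {b // b ∈ D} × {b // b ∈ D}} (hp : key p.1.1 < key p.2.1) :
    (wordAction D n).Stable (fun F => F p.2 < F p.1) := by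
  intro i F G hs h
  rw [wordAction_eq_some] at hs
  subst hs
  unfold move
  split_ifs with hk
  · refine swap_lt_swap i h ?_
    rintro ⟨h1, h2⟩
    rw [← h1, ← h2, Filling.pos_apply, Filling.pos_apply] at hk
    omega
  · exact h

theorem stable_descends {L : List ({b // b ∈ D} × {b // b ∈ D})}
    (hL : ∀ p ∈ L, key p.1.1 < key p.2.1) : (wordAction D n).Stable (Descends L) :=
  fun i F G hs h p hp => stable_descent (hL p hp) i F G hs (h p hp)

theorem stable_someDescent {L : List ({b // b ∈ D} × {b // b ∈ D})}
    (hL : ∀ p ∈ L, key p.1.1 < key p.2.1) : (wordAction D n).Stable (SomeDescent L) := by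
  rintro i F G hs ⟨p, hp, h⟩
  exact ⟨p, hp, stable_descent (hL p hp) i F G hs h⟩

/-- The words with prescribed descents at consecutive places span a direct summand of the regular
module: repeated sorting is a retraction. -/
theorem injectiveCut_descends (hD : Set.InjOn key (D : Set (ℕ × ℕ))) (hcard : D.card = n)
    {L : List ({b // b ∈ D} × {b // b ∈ D})} (hL : ∀ p ∈ L, Consecutive p) :
    (wordAction D n).InjectiveCut (Descends L) (SomeDescent []) := by
  intro hU hV
  have hL' : ∀ p ∈ L, key p.1.1 < key p.2.1 := fun p hp => (hL p hp).1
  have hno : ∀ F : Filling D n, ¬ SomeDescent [] F := by simp [SomeDescent]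
  have : Fintype (Filling D n) := inferInstanceAs (Fintype ({b // b ∈ D} ≃ Fin n))
  let K := (Finset.univ : Finset (Filling D n)).sup letterRank + 1
  let S : Filling D n → Filling D n := (sortSteps L)^[K]
  have hS : ∀ F, Descends L (S F) := fun F => by
    rw [descends_iff hL']
    exact iterate_sortSteps hL' K F
      (Nat.lt_succ_of_le (Finset.le_sup (f := letterRank) (Finset.mem_univ F)))
  have hSfix : ∀ F, Descends L F → S F = F := fun F hF =>
    Function.iterate_fixed (sortSteps_eq_self ((descends_iff hL' F).1 hF)) K
  have hSmove : ∀ i F, S (move i F) = move i (S F) := fun i F =>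
    ((show Function.Commute (sortSteps L) (move i) from
      fun F => sortSteps_move hD hL i F).iterate_left K) F
  let f := ((wordAction D n).restrict (Descends L) (SomeDescent []) hU hV).hom (wordAction D n)
    (fun x => some x.1) (by
      intro i x
      change (cut _ _ (move i x.1)).bind _ = some (move i x.1)
      rw [cut_eq ⟨hU i x.1 _ rfl x.2.1, hno _⟩]
      rfl)
  let g := (wordAction D n).hom ((wordAction D n).restrict (Descends L) (SomeDescent []) hU hV)
    (fun F => some ⟨S F, hS F, hno _⟩) (by
      intro i F
      change some _ = cut _ _ (move i (S F))
      rw [cut_eq ⟨hU i (S F) _ rfl (hS F), hno _⟩]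
      simp only [hSmove])
  refine injective_of_retract (injective_wordAction hD hcard) f g fun x => ?_
  apply (HeckeAction.coeff _).injective
  rw [coeff_hom, coeff_hom, ← LinearMap.comp_apply, partialLin_comp]
  have : (fun x : {x : Filling D n // Descends L x ∧ ¬ SomeDescent [] x} =>
      (some x.1).bind fun F => some (⟨S F, hS F, hno _⟩ :
        {x : Filling D n // Descends L x ∧ ¬ SomeDescent [] x})) = some := by
    funext x
    simp [hSfix x.1 x.2.1]
  rw [this, partialLin_some]
  rfl

/-- The subquotients of the regular module spanned by the words with prescribed descents and
prescribed ascents at consecutive places are injective: prescribing an ascent amounts to taking the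
quotient by the words with a descent at the same place. -/
theorem injectiveCut_descends_someDescent (hD : Set.InjOn key (D : Set (ℕ × ℕ)))
    (hcard : D.card = n) {L M : List ({b // b ∈ D} × {b // b ∈ D})}
    (hL : ∀ p ∈ L, Consecutive p) (hM : ∀ p ∈ M, Consecutive p) :
    (wordAction D n).InjectiveCut (Descends L) (SomeDescent M) := by
  induction M generalizing L with
  | nil => exact injectiveCut_descends hD hcard hL
  | cons p M ih =>
    rw [List.forall_mem_cons] at hM
    have e1 : (SomeDescent (p :: M) : Filling D n → Prop) =
        fun F => SomeDescent M F ∨ F p.2 < F p.1 := by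
      ext F
      simp [SomeDescent, or_comm]
    have e2 : (Descends (p :: L) : Filling D n → Prop) =
        fun F => Descends L F ∧ F p.2 < F p.1 := by
      ext F
      simp [Descends, and_comm]
    rw [e1]
    refine injectiveCut_or (stable_descends fun q hq => (hL q hq).1)
      (stable_someDescent fun q hq => (hM.2 q hq).1) (stable_descent hM.1.1) (ih hL hM.2) ?_
    rw [← e2]
    exact ih (List.forall_mem_cons.2 ⟨hM.1, hL⟩) hM.2

end

noncomputable section

/-! ### Ribbon modules are injective -/

/-- Any two cells are comparable: the diagram runs monotonically to the north-east. -/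
def IsChainDiagram (D : Finset (ℕ × ℕ)) : Prop :=
  ∀ b ∈ D, ∀ b' ∈ D, (b.1 ≤ b'.1 ∧ b.2 ≤ b'.2) ∨ (b'.1 ≤ b.1 ∧ b'.2 ≤ b.2)

theorem IsChainDiagram.injOn_key {D : Finset (ℕ × ℕ)} (hD : IsChainDiagram D) :
    Set.InjOn key (D : Set (ℕ × ℕ)) := by
  intro b hb b' hb' h
  unfold key at h
  rcases hD b hb b' hb' with h' | h' <;> ext <;> omega

theorem IsChainDiagram.le_of_key_lt {D : Finset (ℕ × ℕ)} (hD : IsChainDiagram D) {b b' : ℕ × ℕ}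
    (hb : b ∈ D) (hb' : b' ∈ D) (h : key b < key b') : b.1 ≤ b'.1 ∧ b.2 ≤ b'.2 := by
  unfold key at h
  rcases hD b hb b' hb' with h' | h' <;> omega

theorem isChainDiagram_ribbonCells (c : List ℕ) : IsChainDiagram (ribbonCells c) := by
  induction c with
  | nil => simp [IsChainDiagram, ribbonCells]
  | cons a c ih =>
    intro b hb b' hb'
    simp only [ribbonCells, Finset.mem_union, Finset.mem_image, Finset.mem_range] at hb hb'
    rcases hb with ⟨h, hh, rfl⟩ | ⟨d, hd, rfl⟩ <;>
      rcases hb' with ⟨h', hh', rfl⟩ | ⟨d', hd', rfl⟩ <;> simp only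
    · omega
    · omega
    · omega
    · have := ih d hd d' hd'
      omega

theorem ribbonCells_bound (c : List ℕ) :
    ∀ b ∈ ribbonCells c, b.1 < ribbonHeight c ∧ b.2 < c.length := by
  induction c with
  | nil => simp [ribbonCells]
  | cons a c ih =>
    intro b hb
    simp only [ribbonCells, Finset.mem_union, Finset.mem_image, Finset.mem_range] at hb
    simp only [ribbonHeight, List.map_cons, List.sum_cons, List.length_cons] at ih ⊢
    rcases hb with ⟨h, hh, rfl⟩ | ⟨d, hd, rfl⟩
    · simp only
      omega
    · have := ih d hd
      simp only
      omega

theorem isChainDiagram_genRibbonCells (l : List (List ℕ)) : IsChainDiagram (genRibbonCells l) := by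
  induction l with
  | nil => simp [IsChainDiagram, genRibbonCells]
  | cons c l ih =>
    intro b hb b' hb'
    simp only [genRibbonCells, Finset.mem_union, Finset.mem_image] at hb hb'
    rcases hb with hb | ⟨d, hd, rfl⟩ <;> rcases hb' with hb' | ⟨d', hd', rfl⟩
    · exact isChainDiagram_ribbonCells c b hb b' hb'
    · have := ribbonCells_bound c b hb
      simp only
      omega
    · have := ribbonCells_bound c b' hb'
      simp only
      omega
    · have := ih d hd d' hd'
      simp only
      omega

/-- A transitive relation that holds for consecutive cells holds for all cells. Here `C` is a
condition that a pair of cells passes on to the pairs formed with a cell in between. -/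
theorem rel_of_consecutive {D : Finset (ℕ × ℕ)} {r C : {b // b ∈ D} → {b // b ∈ D} → Prop}
    (htrans : ∀ b w b', r b w → r w b' → r b b')
    (hC : ∀ b w b', key b.1 < key w.1 → key w.1 < key b'.1 → C b b' → C b w ∧ C w b')
    (hr : ∀ p, Consecutive p → C p.1 p.2 → r p.1 p.2) (b b' : {b // b ∈ D})
    (hlt : key b.1 < key b'.1) (h : C b b') : r b b' := by
  induction hd : key b'.1 - key b.1 using Nat.strong_induction_on generalizing b b' with
  | _ d ih =>
    by_cases hw : ∃ w ∈ D, key b.1 < key w ∧ key w < key b'.1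
    · obtain ⟨w, hwD, h1, h2⟩ := hw
      obtain ⟨c1, c2⟩ := hC b ⟨w, hwD⟩ b' h1 h2 h
      exact htrans b ⟨w, hwD⟩ b' (ih _ (by simp only; omega) b ⟨w, hwD⟩ h1 c1 rfl)
        (ih _ (by simp only; omega) ⟨w, hwD⟩ b' h2 c2 rfl)
    · push Not at hw
      refine hr (b, b') ⟨hlt, fun w hwD => ?_⟩ h
      by_contra hcon
      simp only [not_or, not_le] at hcon
      have := hw w hwD hcon.1
      omega

open Filling HeckeAction

variable {n : ℕ}

/-- The action on standard ribbon tableaux. -/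
def ribbonAction (β : GenComposition n) : HeckeAction n (SRT β) :=
  ⟨SRT.act, SRT.act_idem, SRT.act_braid, SRT.act_comm⟩

section

variable (β : GenComposition n)

open Classical in
/-- The pairs of consecutive cells in the same column. -/
def colPairs : List ({b // b ∈ genRibbonCells β.summands} × {b // b ∈ genRibbonCells β.summands}) :=
  (Finset.univ.filter fun p => Consecutive p ∧ p.1.1.2 = p.2.1.2).toList

open Classical in
/-- The pairs of consecutive cells in the same row. -/
def rowPairs : List ({b // b ∈ genRibbonCells β.summands} × {b // b ∈ genRibbonCells β.summands}) :=
  (Finset.univ.filter fun p => Consecutive p ∧ p.1.1.1 = p.2.1.1).toList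

variable {β}

theorem mem_colPairs {p} : p ∈ colPairs β ↔ Consecutive p ∧ p.1.1.2 = p.2.1.2 := by
  simp [colPairs]

theorem mem_rowPairs {p} : p ∈ rowPairs β ↔ Consecutive p ∧ p.1.1.1 = p.2.1.1 := by
  simp [rowPairs]

theorem SRT.descends (T : SRT β) : Descends (colPairs β) T.filling := by
  intro p hp
  rw [mem_colPairs] at hp
  refine T.col_lt p.2 p.1 hp.2.symm ?_
  have := hp.1.1
  unfold key at this
  omega

theorem SRT.not_someDescent (T : SRT β) : ¬ SomeDescent (rowPairs β) T.filling := by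
  rintro ⟨p, hp, h⟩
  rw [mem_rowPairs] at hp
  refine lt_asymm h (T.row_lt p.1 p.2 hp.2 ?_)
  have := hp.1.1
  unfold key at this
  omega

/-- The standard ribbon tableau given by a word with prescribed descents and ascents. -/
def SRT.ofWord (F : Filling (genRibbonCells β.summands) n)
    (h : Descends (colPairs β) F ∧ ¬ SomeDescent (rowPairs β) F) : SRT β where
  filling := F
  row_lt b b' h1 h2 := by
    refine rel_of_consecutive (r := fun b b' => F b < F b') (C := fun b b' => b.1.1 = b'.1.1)
      (fun _ _ _ => lt_trans) ?_ ?_ b b' (by unfold key; omega) h1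
    · intro b w b' hbw hwb hbb
      have g1 := (isChainDiagram_genRibbonCells β.summands).le_of_key_lt b.2 w.2 hbw
      have g2 := (isChainDiagram_genRibbonCells β.summands).le_of_key_lt w.2 b'.2 hwb
      omega
    · intro p hp hpr
      refine lt_of_le_of_ne (not_lt.1 fun hlt => h.2 ⟨p, mem_rowPairs.2 ⟨hp, hpr⟩, hlt⟩) ?_
      intro e
      have := hp.1
      rw [F.injective e] at this
      exact lt_irrefl _ this
  col_lt b b' h1 h2 := by
    refine rel_of_consecutive (r := fun b b' => F b' < F b) (C := fun b b' => b.1.2 = b'.1.2)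
      (fun _ _ _ g1 g2 => lt_trans g2 g1) ?_ ?_ b' b (by unfold key; omega) h1.symm
    · intro b w b' hbw hwb hbb
      have g1 := (isChainDiagram_genRibbonCells β.summands).le_of_key_lt b.2 w.2 hbw
      have g2 := (isChainDiagram_genRibbonCells β.summands).le_of_key_lt w.2 b'.2 hwb
      omega
    · intro p hp hpr
      exact h.1 p (mem_colPairs.2 ⟨hp, hpr⟩)

/-- In a standard ribbon tableau, `i` appears weakly below `i + 1` if and only if it precedes it in
the reading order of the diagram. -/
theorem SRT.isDescent_iff (T : SRT β) (i : Fin (n - 1)) :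
    T.IsDescent i ↔ key (T.filling.pos (lo i)) < key (T.filling.pos (hi i)) := by
  have hch := isChainDiagram_genRibbonCells β.summands
  have hm1 := T.filling.pos_mem (lo i)
  have hm2 := T.filling.pos_mem (hi i)
  have hne : T.filling.pos (lo i) ≠ T.filling.pos (hi i) := fun h =>
    lo_ne_hi i (T.filling.pos_injective h)
  have hne' : key (T.filling.pos (lo i)) ≠ key (T.filling.pos (hi i)) := fun h =>
    hne (hch.injOn_key hm1 hm2 h)
  unfold SRT.IsDescent
  constructor
  · intro h
    by_contra hk
    have hle := hch.le_of_key_lt hm2 hm1 (by omega)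
    have hrow := T.row_lt ⟨_, hm2⟩ ⟨_, hm1⟩ (by simp only; omega) (by
      simp only
      unfold key at hk hne'
      omega)
    have := lo_lt_hi i
    simp only [Filling.pos, Subtype.coe_eta, Equiv.apply_symm_apply] at hrow
    exact lt_asymm this hrow
  · intro h
    exact (hch.le_of_key_lt hm1 hm2 h).1

/-- The action on standard ribbon tableaux is the action on words, followed by cutting off the
words that are no standard ribbon tableaux. -/
theorem SRT.act_eq_cut (i : Fin (n - 1)) (T : SRT β) :
    (SRT.act i T).map SRT.filling =
      (cut (Descends (colPairs β)) (SomeDescent (rowPairs β)) (T.filling.move i)).map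
        Subtype.val := by
  rw [SRT.act]
  split_ifs with hd hr
  · have hk := (T.isDescent_iff i).1 hd
    rw [Filling.move, if_pos hk, cut_eq_none]
    · rfl
    · rintro ⟨h1, h2⟩
      let T' := SRT.ofWord (T.filling.swap i) ⟨h1, h2⟩
      have hm1 := T.filling.pos_mem (lo i)
      have hm2 := T.filling.pos_mem (hi i)
      have hrow := T'.row_lt ⟨_, hm1⟩ ⟨_, hm2⟩ hr (by
        have h := hk
        have h' : _ = _ := hr
        unfold key at h
        simp only
        omega)
      have h1 : T'.filling ⟨_, hm1⟩ = hi i := by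
        simp [T', SRT.ofWord, Filling.swap, Filling.pos]
      have h2 : T'.filling ⟨_, hm2⟩ = lo i := by
        simp [T', SRT.ofWord, Filling.swap, Filling.pos]
      rw [h1, h2] at hrow
      exact lt_asymm (lo_lt_hi i) hrow
  · rw [Filling.move, if_pos ((T.isDescent_iff i).1 hd),
      cut_eq (x := T.filling.swap i) ⟨(T.swap i hd hr).descends, (T.swap i hd hr).not_someDescent⟩]
    rfl
  · rw [Filling.move, if_neg (fun h => hd ((T.isDescent_iff i).2 h)),
      cut_eq ⟨T.descends, T.not_someDescent⟩]
    rfl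

end

theorem injective_ribbonModule (β : GenComposition n) :
    Module.Injective (ZeroHecke n) (RibbonModule β) := by
  by_cases hne : Nonempty (SRT β)
  · obtain ⟨T₀⟩ := hne
    have hcard : (genRibbonCells β.summands).card = n := by
      rw [← Fintype.card_coe, Fintype.card_congr T₀.filling, Fintype.card_fin]
    have hcol : ∀ p ∈ colPairs β, Consecutive p := fun p hp => (mem_colPairs.1 hp).1
    have hrow : ∀ p ∈ rowPairs β, Consecutive p := fun p hp => (mem_rowPairs.1 hp).1
    have hU : (wordAction _ n).Stable (Descends (colPairs β)) :=
      stable_descends fun p hp => (hcol p hp).1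
    have hV : (wordAction _ n).Stable (SomeDescent (rowPairs β)) :=
      stable_someDescent fun p hp => (hrow p hp).1
    have hI := injectiveCut_descends_someDescent
      (isChainDiagram_genRibbonCells β.summands).injOn_key hcard hcol hrow hU hV
    let B := (wordAction (genRibbonCells β.summands) n).restrict _ _ hU hV
    have hact : ∀ i (T : SRT β), (B.s i ⟨T.filling, T.descends, T.not_someDescent⟩) =
        (SRT.act i T).map fun T => ⟨T.filling, T.descends, T.not_someDescent⟩ := by
      intro i T
      apply Option.map_injective Subtype.val_injective
      rw [Option.map_map]
      exact (SRT.act_eq_cut i T).symm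
    let f : (ribbonAction β).Mod →ₗ[ZeroHecke n] B.Mod := HeckeAction.hom _ _
      (fun T => some ⟨T.filling, T.descends, T.not_someDescent⟩) (by
        intro i T
        refine Eq.trans ?_ (hact i T).symm
        change (SRT.act i T).bind _ = _
        cases SRT.act i T <;> rfl)
    let g : B.Mod →ₗ[ZeroHecke n] (ribbonAction β).Mod := HeckeAction.hom _ _
      (fun F => some (SRT.ofWord F.1 F.2)) (by
        intro i F
        change (B.s i F).bind _ = SRT.act i (SRT.ofWord F.1 F.2)
        have h : B.s i F = _ := hact i (SRT.ofWord F.1 F.2)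
        rw [h]
        cases SRT.act i (SRT.ofWord F.1 F.2) <;> rfl)
    have hinj : Module.Injective (ZeroHecke n) (ribbonAction β).Mod := by
      refine injective_of_retract hI f g fun x => ?_
      apply (HeckeAction.coeff _).injective
      rw [coeff_hom, coeff_hom, ← LinearMap.comp_apply, partialLin_comp]
      exact LinearMap.congr_fun partialLin_some _
    exact hinj
  · rw [not_nonempty_iff] at hne
    have hsub : ∀ x : RibbonModule β, x = 0 := fun x =>
      Finsupp.ext (f := (x : SRT β →₀ ℂ)) (g := 0) fun T => hne.elim T
    exact ⟨fun X Y _ _ _ _ j hj k => ⟨0, fun x => (hsub _).trans (hsub _).symm⟩⟩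

end

noncomputable section

/-! ### The cells of the two diagrams -/

/-- The number of cells below the topmost row in the first `j` columns of the diagram built from
the parts `L`. -/
def stack : List ℕ → ℕ → ℕ
  | [], _ => 0
  | _ :: _, 0 => 0
  | a :: L, j + 1 => (a - 1) + stack L j

theorem stack_zero (L : List ℕ) : stack L 0 = 0 := by cases L <;> rfl

theorem stack_succ (L : List ℕ) (j : ℕ) : stack L (j + 1) = stack L j + (L.getD j 0 - 1) := by
  induction L generalizing j with
  | nil => simp [stack]
  | cons a L ih =>
    cases j with
    | zero => simp [stack, stack_zero]
    | succ j =>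
      rw [stack, stack, ih j, List.getD_cons_succ]
      omega

theorem stack_mono (L : List ℕ) : Monotone (stack L) :=
  monotone_nat_of_le_succ fun j => by
    rw [stack_succ]
    omega

theorem mem_ribbonCells_replicate (l : ℕ) (b : ℕ × ℕ) :
    b ∈ ribbonCells (List.replicate l 1) ↔ b.1 = 0 ∧ b.2 < l := by
  obtain ⟨h, c⟩ := b
  induction l generalizing h c with
  | zero => simp [ribbonCells]
  | succ l ih =>
    simp only [List.replicate_succ, ribbonCells, Finset.mem_union, Finset.mem_image,
      Finset.mem_range, Prod.exists, Prod.mk.injEq, ih]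
    constructor
    · rintro (⟨x, hx, rfl, rfl⟩ | ⟨x, y, ⟨rfl, hy⟩, rfl, rfl⟩) <;> omega
    · rintro ⟨rfl, hc⟩
      rcases Nat.eq_zero_or_pos c with rfl | hc0
      · exact Or.inl ⟨0, by omega, rfl, rfl⟩
      · exact Or.inr ⟨0, c - 1, ⟨rfl, by omega⟩, rfl, by omega⟩

/-- The cells of the diagram of `α.tilde`: the topmost row, and below it columns of the lengths
`a - 1` for the parts `a > 1`, one above the other. -/
theorem mem_genRibbonCells_tildeSummands (l : ℕ) (L : List ℕ) (hL : ∀ a ∈ L, 1 < a)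
    (hl : L ≠ [] → 0 < l) (b : ℕ × ℕ) :
    b ∈ genRibbonCells (tildeSummands l L) ↔
      (b.1 = stack L L.length ∧ L.length - 1 ≤ b.2 ∧ b.2 < L.length - 1 + l) ∨
        (b.2 < L.length ∧ stack L b.2 ≤ b.1 ∧ b.1 < stack L (b.2 + 1)) := by
  obtain ⟨h, c⟩ := b
  fun_induction tildeSummands l L generalizing h c with
  | case1 h0 => simp [genRibbonCells, h0]
  | case2 h0 =>
    simp [genRibbonCells, mem_ribbonCells_replicate, stack]
  | case3 a =>
    have ha := hL a (by simp)
    have hl' := hl (by simp)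
    simp only [genRibbonCells, ribbonCells, Finset.mem_union, Finset.mem_image, Finset.mem_range,
      Finset.image_empty, Finset.union_empty, List.length_singleton, Prod.exists, Prod.mk.injEq,
      mem_ribbonCells_replicate, stack]
    constructor
    · rintro (⟨x, hx, rfl, rfl⟩ | ⟨x, y, ⟨rfl, hy⟩, rfl, rfl⟩)
      · rw [stack_zero]
        omega
      · omega
    · rintro (⟨rfl, _, hc⟩ | ⟨hc, h1, h2⟩)
      · rcases Nat.eq_zero_or_pos c with rfl | hc0
        · exact Or.inl ⟨a - 1, by omega, by omega, rfl⟩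
        · exact Or.inr ⟨0, c - 1, ⟨rfl, by omega⟩, by omega, by omega⟩
      · have : c = 0 := by omega
        subst this
        rw [stack_zero] at h1
        exact Or.inl ⟨h, by omega, rfl, rfl⟩
  | case4 a a' t ih =>
    have ha := hL a (by simp)
    have ih' := ih (fun x hx => hL x (List.mem_cons_of_mem _ hx)) (fun _ => hl (by simp))
    have hh : ribbonHeight [a - 1] = a - 1 := by
      simp [ribbonHeight]
      omega
    simp only [genRibbonCells, ribbonCells, Finset.mem_union, Finset.mem_image, Finset.mem_range,
      Finset.image_empty, Finset.union_empty, Prod.exists, Prod.mk.injEq, ih', hh]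
    have e1 : stack (a :: a' :: t) (a :: a' :: t).length =
      (a - 1) + stack (a' :: t) (a' :: t).length := rfl
    have e2 : ∀ j, stack (a :: a' :: t) (j + 1) = (a - 1) + stack (a' :: t) j := fun _ => rfl
    have e3 : (a :: a' :: t).length = (a' :: t).length + 1 := rfl
    have e4 : 0 < (a' :: t).length := by simp
    have e5 : [a - 1].length = 1 := rfl
    rw [e1, e3, e5]
    constructor
    · rintro (⟨x, hx, rfl, rfl⟩ | ⟨x, y, hxy, rfl, rfl⟩)
      · right
        rw [e2, stack_zero, stack_zero]
        omega
      · rw [e2, e2]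
        omega
    · intro hc
      rcases Nat.eq_zero_or_pos c with rfl | hc0
      · rw [e2, stack_zero, stack_zero] at hc
        exact Or.inl ⟨h, by omega, rfl, rfl⟩
      · obtain ⟨c, rfl⟩ : ∃ c', c = c' + 1 := ⟨c - 1, by omega⟩
        rw [e2, e2] at hc
        exact Or.inr ⟨h - (a - 1), c, by omega, by omega, rfl⟩

variable {n : ℕ} (α : Composition n)

/-- The number of cells in the row `r`. -/
def rowLen (r : ℕ) : ℕ := α.blocks.getD r 0

theorem blocks_eq_map : α.blocks = (List.range α.length).map (rowLen α) := by
  apply List.ext_getElem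
  · simp
  · intro i h1 h2
    simp [rowLen, h1]

theorem filter_blocks : α.blocks.filter (fun a => 1 < a) = (longRows α).map (rowLen α) := by
  conv_lhs => rw [blocks_eq_map α, List.filter_map]
  rfl

theorem rowLen_pos {r : ℕ} (hr : r < α.length) : 0 < rowLen α r := by
  have hr' : r < α.blocks.length := by rwa [α.blocks_length]
  rw [rowLen, List.getD_eq_getElem _ _ hr']
  exact α.blocks_pos (List.getElem_mem hr')

theorem rowLen_le (r : ℕ) : rowLen α r ≤ n := by
  by_cases hr : r < α.blocks.length
  · rw [rowLen, List.getD_eq_getElem _ _ hr]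
    conv_rhs => rw [← α.blocks_sum]
    exact List.le_sum_of_mem (List.getElem_mem hr)
  · rw [rowLen, List.getD_eq_default _ _ (not_lt.1 hr)]
    exact Nat.zero_le n

theorem mem_compCells (b : ℕ × ℕ) : b ∈ compCells α ↔ b.1 < α.length ∧ b.2 < rowLen α b.1 := by
  have := rowLen_le α b.1
  simp only [compCells, Finset.mem_filter, Finset.mem_product, Finset.mem_range]
  unfold rowLen at *
  omega

/-- The number of long rows. -/
def numLong : ℕ := (longRows α).length

/-- The `j`-th long row. -/
def longRow (j : ℕ) : ℕ := (longRows α).getD j 0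

/-- The height of the lowest cell of the `j`-th column of the ribbon diagram. -/
def base (j : ℕ) : ℕ := stack (α.blocks.filter fun a => 1 < a) j

/-- The height of the topmost row of the ribbon diagram. -/
def topHeight : ℕ := base α (numLong α)

variable {α}

theorem longRow_mem {j : ℕ} (hj : j < numLong α) : longRow α j ∈ longRows α := by
  rw [longRow, List.getD_eq_getElem _ _ hj]
  exact List.getElem_mem _

theorem longRow_lt {j : ℕ} (hj : j < numLong α) : longRow α j < α.length := by
  have := longRow_mem hj
  simp only [longRows, List.mem_filter, List.mem_range] at this
  exact this.1

theorem one_lt_rowLen {j : ℕ} (hj : j < numLong α) : 1 < rowLen α (longRow α j) := by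
  have := longRow_mem hj
  simp only [longRows, List.mem_filter, decide_eq_true_eq] at this
  exact this.2

theorem exists_longRow {r : ℕ} (hr : r < α.length) (h : 1 < rowLen α r) :
    ∃ j < numLong α, longRow α j = r := by
  have : r ∈ longRows α := by
    simp only [longRows, List.mem_filter, List.mem_range, decide_eq_true_eq]
    exact ⟨hr, h⟩
  obtain ⟨j, hj, rfl⟩ := List.getElem_of_mem this
  exact ⟨j, hj, List.getD_eq_getElem _ _ hj⟩

theorem longRow_lt_longRow {j j' : ℕ} (hj' : j' < numLong α) (h : j < j') :
    longRow α j < longRow α j' := by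
  have hs : (longRows α).Pairwise (· < ·) := List.Pairwise.filter _ List.pairwise_lt_range
  rw [longRow, longRow, List.getD_eq_getElem _ _ (h.trans hj'), List.getD_eq_getElem _ _ hj']
  exact List.pairwise_iff_getElem.1 hs j j' _ _ h

theorem longRows_getElem? {j r : ℕ} (hj : j < numLong α) :
    (longRows α)[j]? = some r ↔ longRow α j = r := by
  rw [longRow, List.getD_eq_getElem _ _ hj, List.getElem?_eq_getElem hj, Option.some_inj]

theorem base_succ {j : ℕ} (hj : j < numLong α) :
    base α (j + 1) = base α j + (rowLen α (longRow α j) - 1) := by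
  rw [base, stack_succ]
  congr 2
  rw [filter_blocks, longRow, List.getD_eq_getElem _ _ hj, List.getD_eq_getElem _ _ (by rwa [List.length_map]),
    List.getElem_map]
  rfl

theorem base_mono {j j' : ℕ} (h : j ≤ j') : base α j ≤ base α j' := stack_mono _ h

theorem base_lt {j : ℕ} (hj : j < numLong α) : base α j < base α (j + 1) := by
  have := base_succ hj
  have := one_lt_rowLen hj
  omega

theorem mem_ribbonCells (b : ℕ × ℕ) :
    b ∈ genRibbonCells α.tilde.summands ↔
      (b.1 = topHeight α ∧ numLong α - 1 ≤ b.2 ∧ b.2 < numLong α - 1 + α.length) ∨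
        (b.2 < numLong α ∧ base α b.2 ≤ b.1 ∧ b.1 < base α (b.2 + 1)) := by
  have hlen : (α.blocks.filter fun a => 1 < a).length = numLong α := by
    rw [filter_blocks, List.length_map]
    rfl
  change b ∈ genRibbonCells (tildeSummands α.length (α.blocks.filter fun a => 1 < a)) ↔ _
  rw [mem_genRibbonCells_tildeSummands, hlen]
  · rfl
  · simp
  · intro h
    rw [← List.length_pos_iff, hlen] at h
    exact (Nat.zero_le _).trans_lt (longRow_lt h)

theorem topRow_iff {b : ℕ × ℕ} (hb : b ∈ genRibbonCells α.tilde.summands) :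
    topRow α.tilde b ↔ b.1 = topHeight α := by
  have hle : ∀ b ∈ genRibbonCells α.tilde.summands, b.1 ≤ topHeight α := by
    intro b hb
    rw [mem_ribbonCells] at hb
    rcases hb with hb | hb
    · exact hb.1.le
    · exact hb.2.2.le.trans (base_mono hb.1)
  have hlen : 0 < α.length := by
    rw [mem_ribbonCells] at hb
    rcases hb with hb | hb
    · omega
    · exact (Nat.zero_le _).trans_lt (longRow_lt hb.1)
  constructor
  · intro h
    refine le_antisymm (hle b hb) (h.2 (topHeight α, numLong α - 1) ?_)
    rw [mem_ribbonCells]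
    exact Or.inl ⟨rfl, le_rfl, by simp only; omega⟩
  · intro h
    exact ⟨hb, fun b' hb' => h ▸ hle b' hb'⟩

variable (α) in
/-- The correspondence of the cells of the two diagrams that respects the strips: the `r`-th cell
of the topmost row belongs to the leftmost cell of the row `r`, and the `j`-th column, read from top
to bottom, to the `j`-th long row without its leftmost cell. -/
def toComp (b : ℕ × ℕ) : ℕ × ℕ :=
  if b.1 = topHeight α then (b.2 - (numLong α - 1), 0)
  else (longRow α b.2, base α (b.2 + 1) - b.1)

/-- The two kinds of cells. -/
theorem ribbonCells_cases {b : ℕ × ℕ} (hb : b ∈ genRibbonCells α.tilde.summands) :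
    (b.1 = topHeight α ∧ ∃ r < α.length, b.2 = numLong α - 1 + r ∧ toComp α b = (r, 0)) ∨
      (b.1 < topHeight α ∧ b.2 < numLong α ∧ base α b.2 ≤ b.1 ∧ b.1 < base α (b.2 + 1) ∧
        toComp α b = (longRow α b.2, base α (b.2 + 1) - b.1)) := by
  rw [mem_ribbonCells] at hb
  rcases hb with hb | hb
  · refine Or.inl ⟨hb.1, b.2 - (numLong α - 1), by omega, by omega, ?_⟩
    rw [toComp, if_pos hb.1]
  · have h : b.1 < topHeight α := lt_of_lt_of_le hb.2.2 (base_mono hb.1)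
    refine Or.inr ⟨h, hb.1, hb.2.1, hb.2.2, ?_⟩
    rw [toComp, if_neg h.ne]

theorem toComp_mem {b : ℕ × ℕ} (hb : b ∈ genRibbonCells α.tilde.summands) :
    toComp α b ∈ compCells α := by
  rw [mem_compCells]
  rcases ribbonCells_cases hb with ⟨_, r, hr, _, h⟩ | ⟨_, hj, h1, h2, h⟩ <;> rw [h]
  · exact ⟨hr, rowLen_pos α hr⟩
  · have := base_succ hj
    exact ⟨longRow_lt hj, by simp only; omega⟩

variable (α) in
theorem bijective_toComp : Function.Bijective
    (fun b : {b // b ∈ genRibbonCells α.tilde.summands} =>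
      (⟨toComp α b.1, toComp_mem b.2⟩ : {b // b ∈ compCells α})) := by
  constructor
  · rintro ⟨b, hb⟩ ⟨b', hb'⟩ h
    have h := congrArg Subtype.val h
    simp only at h
    apply Subtype.ext
    simp only
    rcases ribbonCells_cases hb with ⟨h1, r, hr, h2, h3⟩ | ⟨h1, h2, h3, h4, h5⟩ <;>
      rcases ribbonCells_cases hb' with ⟨h1', r', hr', h2', h3'⟩ | ⟨h1', h2', h3', h4', h5'⟩
    · rw [h3, h3', Prod.mk.injEq] at h
      ext <;> omega
    · rw [h3, h5', Prod.mk.injEq] at h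
      omega
    · rw [h5, h3', Prod.mk.injEq] at h
      omega
    · rw [h5, h5', Prod.mk.injEq] at h
      have hj : b.2 = b'.2 := by
        rcases lt_trichotomy b.2 b'.2 with hlt | heq | hlt
        · have := longRow_lt_longRow h2' hlt
          omega
        · exact heq
        · have := longRow_lt_longRow h2 hlt
          omega
      rw [hj] at h h4
      ext <;> omega
  · rintro ⟨⟨r, c⟩, hc⟩
    have hc' := hc
    rw [mem_compCells] at hc'
    simp only at hc'
    rcases Nat.eq_zero_or_pos c with rfl | hc0
    · refine ⟨⟨(topHeight α, numLong α - 1 + r), ?_⟩, ?_⟩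
      · rw [mem_ribbonCells]
        exact Or.inl ⟨rfl, by simp only; omega, by simp only; omega⟩
      · apply Subtype.ext
        simp [toComp]
    · obtain ⟨j, hj, rfl⟩ := exists_longRow hc'.1 (by omega)
      have h1 := base_succ hj
      have h2 := one_lt_rowLen hj
      have h3 : base α (j + 1) ≤ topHeight α := base_mono hj
      refine ⟨⟨(base α (j + 1) - c, j), ?_⟩, ?_⟩
      · rw [mem_ribbonCells]
        simp only
        omega
      · apply Subtype.ext
        simp only [toComp]
        rw [if_neg (by omega)]
        ext <;> simp only
        omega

variable (α) in
/-- The bijection between the cells of the two diagrams that respects the strips. -/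
def cellEquiv : {b // b ∈ genRibbonCells α.tilde.summands} ≃ {b // b ∈ compCells α} :=
  Equiv.ofBijective _ (bijective_toComp α)

theorem cellEquiv_val (b : {b // b ∈ genRibbonCells α.tilde.summands}) :
    (cellEquiv α b).1 = toComp α b.1 := rfl

theorem ribbonStrip_iff {j : ℕ} (hj : j ≤ numLong α) {b : ℕ × ℕ}
    (hb : b ∈ genRibbonCells α.tilde.summands) :
    ribbonStrip α j b ↔ compStrip α j (toComp α b) := by
  have hm := toComp_mem hb
  cases j with
  | zero =>
    simp only [ribbonStrip, compStrip, topRow_iff hb, hm, true_and]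
    rcases ribbonCells_cases hb with ⟨h1, r, hr, h2, h3⟩ | ⟨h1, h2, h3, h4, h5⟩
    · simp [h1, h3]
    · rw [h5]
      simp only
      omega
  | succ j =>
    simp only [ribbonStrip, compStrip, topRow_iff hb, hm, true_and, hb]
    rw [longRows_getElem? (by omega)]
    rcases ribbonCells_cases hb with ⟨h1, r, hr, h2, h3⟩ | ⟨h1, h2, h3, h4, h5⟩
    · simp [h1, h3]
    · rw [h5]
      simp only
      constructor
      · rintro ⟨rfl, _⟩
        exact ⟨rfl, by omega⟩
      · rintro ⟨h, _⟩
        refine ⟨?_, h1.ne⟩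
        rcases lt_trichotomy b.2 j with hlt | heq | hlt
        · have := longRow_lt_longRow (show j < numLong α by omega) hlt
          omega
        · exact heq
        · have := longRow_lt_longRow h2 hlt
          omega

end

noncomputable section

/-! ### The ribbon tableau of a standard immaculate tableau -/

open Filling HeckeAction

variable {n : ℕ} {α : Composition n}

theorem Filling.apply_pos {D : Finset (ℕ × ℕ)} (F : Filling D n) (k : Fin n) (h : F.pos k ∈ D) :
    F ⟨F.pos k, h⟩ = k := by
  simp [Filling.pos]

/-- The ribbon tableau with the same entries in corresponding cells. -/
def SIT.toSRT (T : SIT α) : SRT α.tilde where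
  filling := (cellEquiv α).trans T.filling
  row_lt b b' h1 h2 := by
    change T.filling (cellEquiv α b) < T.filling (cellEquiv α b')
    rcases ribbonCells_cases b.2 with ⟨c1, r, hr, c2, c3⟩ | ⟨c1, c2, c3, c4, c5⟩ <;>
      rcases ribbonCells_cases b'.2 with ⟨c1', r', hr', c2', c3'⟩ | ⟨c1', c2', c3', c4', c5'⟩
    · refine T.col_lt _ _ ?_ ?_ ?_ <;> simp only [cellEquiv_val, c3, c3']
      omega
    · omega
    · omega
    · have := base_mono (α := α) (show b.1.2 + 1 ≤ b'.1.2 from h2)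
      omega
  col_lt b b' h1 h2 := by
    change T.filling (cellEquiv α b) < T.filling (cellEquiv α b')
    rcases ribbonCells_cases b.2 with ⟨c1, r, hr, c2, c3⟩ | ⟨c1, c2, c3, c4, c5⟩ <;>
      rcases ribbonCells_cases b'.2 with ⟨c1', r', hr', c2', c3'⟩ | ⟨c1', c2', c3', c4', c5'⟩
    · omega
    · have hr0 : r = 0 := by omega
      have hlt := longRow_lt c2'
      let b₀ : {b // b ∈ compCells α} :=
        ⟨(longRow α b'.1.2, 0), (mem_compCells α _).2 ⟨hlt, rowLen_pos α hlt⟩⟩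
      have g1 : T.filling (cellEquiv α b) ≤ T.filling b₀ := by
        rcases Nat.eq_zero_or_pos (longRow α b'.1.2) with h0 | h0
        · refine le_of_eq (congrArg _ (Subtype.ext ?_))
          rw [cellEquiv_val, c3, hr0]
          simp only [b₀, h0]
        · refine le_of_lt (T.col_lt _ _ ?_ rfl ?_)
          · rw [cellEquiv_val, c3]
          · rw [cellEquiv_val, c3]
            exact hr0 ▸ h0
      refine lt_of_le_of_lt g1 (T.row_lt _ _ ?_ ?_)
      · rw [cellEquiv_val, c5']
      · rw [cellEquiv_val, c5']
        simp only [b₀]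
        omega
    · omega
    · refine T.row_lt _ _ ?_ ?_
      · rw [cellEquiv_val, cellEquiv_val, c5, c5', h1]
      · rw [cellEquiv_val, cellEquiv_val, c5, c5', h1]
        simp only
        rw [h1] at c4
        omega

/-- An entry is in corresponding cells of the two tableaux. -/
theorem SIT.pos_eq (T : SIT α) (k : Fin n) :
    T.filling.pos k = toComp α (T.toSRT.filling.pos k) := by
  rw [← cellEquiv_val ⟨_, T.toSRT.filling.pos_mem k⟩]
  simp [Filling.pos, SIT.toSRT]

theorem SIT.isRibbonTableauOf_toSRT (T : SIT α) : IsRibbonTableauOf T T.toSRT := by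
  intro j hj
  ext k
  change ribbonStrip α j _ ↔ compStrip α j _
  rw [T.pos_eq]
  exact ribbonStrip_iff hj (T.toSRT.filling.pos_mem k)

/-- Every cell lies in a strip. -/
theorem exists_ribbonStrip {b : ℕ × ℕ} (hb : b ∈ genRibbonCells α.tilde.summands) :
    ∃ j ≤ numLong α, ribbonStrip α j b := by
  rcases ribbonCells_cases hb with ⟨h1, _⟩ | ⟨h1, h2, _⟩
  · exact ⟨0, Nat.zero_le _, (topRow_iff hb).2 h1⟩
  · exact ⟨b.2 + 1, h2, hb, rfl, fun h => h1.ne ((topRow_iff hb).1 h)⟩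

/-- Two cells of the same strip are in the same row or in the same column. -/
theorem row_or_col_of_ribbonStrip {j : ℕ} {b b' : ℕ × ℕ}
    (hb : b ∈ genRibbonCells α.tilde.summands) (hb' : b' ∈ genRibbonCells α.tilde.summands)
    (h : ribbonStrip α j b) (h' : ribbonStrip α j b') : b.1 = b'.1 ∨ b.2 = b'.2 := by
  cases j with
  | zero => exact Or.inl (((topRow_iff hb).1 h).trans ((topRow_iff hb').1 h').symm)
  | succ j => exact Or.inr (h.2.1.trans h'.2.1.symm)

/-- The order of the entries of two cells in the same row or column does not depend on the
tableau. -/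
theorem SRT.lt_iff_lt {β : GenComposition n} (R R' : SRT β)
    {b b' : {b // b ∈ genRibbonCells β.summands}} (h : b.1.1 = b'.1.1 ∨ b.1.2 = b'.1.2) :
    R.filling b < R.filling b' ↔ R'.filling b < R'.filling b' := by
  have hkey : ∀ {b b' : {b // b ∈ genRibbonCells β.summands}},
      b.1.1 = b'.1.1 ∨ b.1.2 = b'.1.2 → (b.1.2 < b'.1.2 ∨ b'.1.1 < b.1.1) →
      ∀ R : SRT β, R.filling b < R.filling b' := by
    intro b b' h h' R
    rcases h with h | h
    · exact R.row_lt b b' h (by omega)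
    · exact R.col_lt b b' h (by omega)
  by_cases h1 : b.1.2 < b'.1.2 ∨ b'.1.1 < b.1.1
  · simp only [hkey h h1]
  by_cases h2 : b'.1.2 < b.1.2 ∨ b.1.1 < b'.1.1
  · have h' : b'.1.1 = b.1.1 ∨ b'.1.2 = b.1.2 := by omega
    simp only [(hkey h' h2 _).not_gt]
  · have : b = b' := by
      apply Subtype.ext
      ext <;> omega
    subst this
    simp only [lt_self_iff_false]

/-- A standard ribbon tableau is determined by the sets of entries of its strips. -/
theorem SRT.eq_of_entries_eq {R R' : SRT α.tilde}
    (h : ∀ j ≤ numLong α,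
      R.filling.entries (ribbonStrip α j) = R'.filling.entries (ribbonStrip α j)) : R = R' := by
  have hpos : ∀ k, R.filling.pos k = R'.filling.pos k := by
    intro k
    induction k using WellFoundedLT.induction with
    | _ k ih =>
      have hm := R.filling.pos_mem k
      have hm' := R'.filling.pos_mem k
      obtain ⟨j, hj, hs⟩ := exists_ribbonStrip hm
      have hs' : ribbonStrip α j (R'.filling.pos k) := by
        have : k ∈ R.filling.entries (ribbonStrip α j) := hs
        rw [h j hj] at this
        exact this
      have hrc := row_or_col_of_ribbonStrip hm hm' hs hs'
      let b : {b // b ∈ genRibbonCells α.tilde.summands} := ⟨_, hm⟩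
      let b' : {b // b ∈ genRibbonCells α.tilde.summands} := ⟨_, hm'⟩
      have e1 : R.filling b = k := R.filling.apply_pos k hm
      have e2 : R'.filling b' = k := R'.filling.apply_pos k hm'
      rcases lt_trichotomy (R'.filling b) (R'.filling b') with hlt | heq | hlt
      · have := ih (R'.filling b) (hlt.trans_eq e2)
        rw [Filling.pos_apply] at this
        have := R.filling.pos_injective this
        rw [this, e2] at hlt
        exact absurd hlt (lt_irrefl k)
      · exact congrArg Subtype.val (R'.filling.injective heq)
      · have hlt' := (R'.lt_iff_lt R (b := b') (b' := b) (by simp only [b, b']; omega)).1 hlt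
        have := ih (R.filling b') (hlt'.trans_eq e1)
        rw [Filling.pos_apply] at this
        have := R'.filling.pos_injective (this.symm : R'.filling.pos _ = R'.filling.pos k)
        rw [this, e1] at hlt'
        exact absurd hlt' (lt_irrefl k)
  apply SRT.ext
  have : R.filling.symm = R'.filling.symm := by
    ext1 k
    exact Subtype.ext (hpos k)
  rw [← Equiv.symm_symm R.filling, this, Equiv.symm_symm]

theorem isRibbonTableauOf_iff {T : SIT α} {R : SRT α.tilde} :
    IsRibbonTableauOf T R ↔ R = T.toSRT := by
  constructor
  · intro h
    exact SRT.eq_of_entries_eq fun j hj =>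
      (h j hj).trans (T.isRibbonTableauOf_toSRT j hj).symm
  · rintro rfl
    exact T.isRibbonTableauOf_toSRT

theorem SIT.toSRT_injective : Function.Injective (SIT.toSRT (α := α)) := by
  intro T T' h
  apply SIT.ext
  have := congrArg SRT.filling h
  simp only [SIT.toSRT] at this
  ext b
  have := DFunLike.congr_fun this ((cellEquiv α).symm b)
  simpa using congrArg Fin.val this

/-- The action of the generators is compatible with the passage to ribbon tableaux. -/
theorem SIT.act_toSRT (i : Fin (n - 1)) (T : SIT α) :
    SRT.act i T.toSRT = (SIT.act i T).map SIT.toSRT := by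
  have hlh := lo_lt_hi i
  have hm := T.toSRT.filling.pos_mem (lo i)
  have hm' := T.toSRT.filling.pos_mem (hi i)
  have hp := T.pos_eq (lo i)
  have hp' := T.pos_eq (hi i)
  have hd : T.toSRT.IsDescent i ↔
    (T.toSRT.filling.pos (lo i)).1 ≤ (T.toSRT.filling.pos (hi i)).1 := Iff.rfl
  have hr : T.toSRT.SameRow i ↔
    (T.toSRT.filling.pos (lo i)).1 = (T.toSRT.filling.pos (hi i)).1 := Iff.rfl
  have hd' : T.IsDescent i ↔ (T.filling.pos (lo i)).1 < (T.filling.pos (hi i)).1 := Iff.rfl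
  have hc' : T.FirstCol i ↔
    (T.filling.pos (lo i)).2 = 0 ∧ (T.filling.pos (hi i)).2 = 0 := Iff.rfl
  -- the two rules agree case by case
  have hkill : T.toSRT.IsDescent i → T.toSRT.SameRow i → T.IsDescent i → T.FirstCol i →
      SRT.act i T.toSRT = (SIT.act i T).map SIT.toSRT := by
    intro h1 h2 h3 h4
    rw [SRT.act, SIT.act, dif_pos h1, dif_pos h2, dif_pos h3, dif_pos h4]
    rfl
  have hswap : T.toSRT.IsDescent i → ¬ T.toSRT.SameRow i → T.IsDescent i → ¬ T.FirstCol i →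
      SRT.act i T.toSRT = (SIT.act i T).map SIT.toSRT := by
    intro h1 h2 h3 h4
    rw [SRT.act, SIT.act, dif_pos h1, dif_neg h2, dif_pos h3, dif_neg h4]
    rfl
  have hfix : ¬ T.toSRT.IsDescent i → ¬ T.IsDescent i →
      SRT.act i T.toSRT = (SIT.act i T).map SIT.toSRT := by
    intro h1 h2
    rw [SRT.act, SIT.act, dif_neg h1, dif_neg h2]
    rfl
  -- the rows through the cells of the two entries
  have hrow : ∀ (k : Fin n) (b : ℕ × ℕ), T.filling.pos k = b → b.2 ≠ 0 →
      ∃ hb : (b.1, 0) ∈ compCells α, T.filling ⟨_, hb⟩ < k := by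
    intro k b hk hb0
    have hkm := T.filling.pos_mem k
    have hkm' := hkm
    rw [hk, mem_compCells] at hkm'
    have hb : (b.1, 0) ∈ compCells α := by
      rw [mem_compCells]
      exact ⟨hkm'.1, rowLen_pos α hkm'.1⟩
    refine ⟨hb, ?_⟩
    have := T.row_lt ⟨_, hb⟩ ⟨_, hkm⟩ (by simp only [hk]) (by
      simp only [hk]
      omega)
    rwa [T.filling.apply_pos] at this
  have hmT := T.filling.pos_mem (lo i)
  have hmT' := T.filling.pos_mem (hi i)
  have eT := T.filling.apply_pos (lo i) hmT
  have eT' := T.filling.apply_pos (hi i) hmT'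
  rcases ribbonCells_cases hm with ⟨c1, r, hr0, c2, c3⟩ | ⟨c1, c2, c3, c4, c5⟩ <;>
    rcases ribbonCells_cases hm' with ⟨c1', r', hr', c2', c3'⟩ | ⟨c1', c2', c3', c4', c5'⟩
  · rw [c3] at hp
    rw [c3'] at hp'
    refine hkill (hd.2 (by omega)) (hr.2 (by omega)) (hd'.2 ?_) (hc'.2 ?_)
    · rw [hp, hp']
      simp only
      by_contra hlt
      rcases (not_lt.1 hlt).lt_or_eq with hlt | heq
      · have := T.col_lt ⟨_, hmT'⟩ ⟨_, hmT⟩ (by simp only [hp']) (by simp only [hp])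
          (by simp only [hp, hp']; exact hlt)
        rw [eT, eT'] at this
        exact lt_asymm this hlh
      · exact lo_ne_hi i (T.filling.pos_injective (by rw [hp, hp', heq]))
    · rw [hp, hp']
      exact ⟨rfl, rfl⟩
  · rw [c3] at hp
    rw [c5'] at hp'
    refine hfix (fun h => ?_) (fun h => ?_)
    · rw [hd] at h
      omega
    · rw [hd', hp, hp'] at h
      simp only at h
      obtain ⟨hb, hlt⟩ := hrow (hi i) _ hp' (by simp only; omega)
      have := T.col_lt ⟨_, hmT⟩ ⟨_, hb⟩ (by simp only [hp]) rfl (by simp only [hp]; exact h)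
      rw [eT] at this
      simp only [lo, hi, Fin.lt_def] at this hlt
      omega
  · rw [c5] at hp
    rw [c3'] at hp'
    refine hswap (hd.2 (by omega)) (fun h => ?_) (hd'.2 ?_) (fun h => ?_)
    · rw [hr] at h
      omega
    · rw [hp, hp']
      simp only
      by_contra hlt
      obtain ⟨hb, hlt'⟩ := hrow (lo i) _ hp (by simp only; omega)
      simp only at hb hlt'
      rcases (not_lt.1 hlt).lt_or_eq with hlt | heq
      · have := T.col_lt ⟨_, hmT'⟩ ⟨_, hb⟩ (by simp only [hp']) rfl (by simp only [hp']; exact hlt)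
        rw [eT'] at this
        exact lt_asymm (this.trans hlt') hlh
      · have : T.filling ⟨_, hb⟩ = hi i := by
          rw [← eT']
          exact congrArg _ (Subtype.ext ((congrArg (fun x => (x, 0)) heq.symm).trans hp'.symm))
        rw [this] at hlt'
        exact lt_asymm hlt' hlh
    · rw [hc', hp] at h
      simp only at h
      omega
  · rw [c5] at hp
    rw [c5'] at hp'
    rcases lt_trichotomy (T.toSRT.filling.pos (lo i)).2 (T.toSRT.filling.pos (hi i)).2 with
      hj | hj | hj
    · have h1 := base_mono (α := α) hj
      have h2 := longRow_lt_longRow c2' hj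
      refine hswap (hd.2 ?_) (fun h => ?_) (hd'.2 ?_) (fun h => ?_)
      · simp only [Nat.succ_eq_add_one] at h1
        omega
      · rw [hr] at h
        simp only [Nat.succ_eq_add_one] at h1
        omega
      · rw [hp, hp']
        exact h2
      · rw [hc', hp] at h
        simp only at h
        omega
    · refine hfix (fun h => ?_) (fun h => ?_)
      · rw [hd] at h
        rcases h.lt_or_eq with h | h
        · have := T.toSRT.col_lt ⟨_, hm'⟩ ⟨_, hm⟩ hj.symm h
          rw [Filling.apply_pos, Filling.apply_pos] at this
          exact lt_asymm this hlh
        · exact lo_ne_hi i (T.toSRT.filling.pos_injective (Prod.ext h hj))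
      · rw [hd', hp, hp', hj] at h
        exact lt_irrefl _ h
    · have h1 := base_mono (α := α) hj
      have h2 := longRow_lt_longRow c2 hj
      refine hfix (fun h => ?_) (fun h => ?_)
      · rw [hd] at h
        simp only [Nat.succ_eq_add_one] at h1
        omega
      · rw [hd', hp, hp'] at h
        simp only at h
        omega

variable (α) in
/-- The action on standard immaculate tableaux. -/
def immaculateAction : HeckeAction n (SIT α) :=
  ⟨SIT.act, SIT.act_idem, SIT.act_braid, SIT.act_comm⟩

variable (α) in
/-- The embedding of `V_α` into the ribbon module. -/
def immaculateHom : (immaculateAction α).Mod →ₗ[ZeroHecke n] (ribbonAction α.tilde).Mod :=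
  (immaculateAction α).hom (ribbonAction α.tilde) (fun T => some T.toSRT) (by
    intro i T
    change (SIT.act i T).bind _ = SRT.act i T.toSRT
    rw [SIT.act_toSRT]
    cases SIT.act i T <;> rfl)

theorem coeff_immaculateHom_toSRT (v : (immaculateAction α).Mod) (T : SIT α) :
    (ribbonAction α.tilde).coeff (immaculateHom α v) T.toSRT =
      (immaculateAction α).coeff v T :=
  partialLin_apply_of_unique _ _ rfl fun _ _ h =>
    SIT.toSRT_injective (Option.some_injective _ h)

theorem immaculateHom_injective : Function.Injective (immaculateHom α) := by
  intro v w h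
  apply (immaculateAction α).coeff.injective
  ext T
  rw [← coeff_immaculateHom_toSRT, ← coeff_immaculateHom_toSRT, h]

/-- All entries of the topmost row are smaller than the other entries. -/
def SRT.TopFirst (R : SRT α.tilde) : Prop :=
  ∀ b b', b.1.1 = topHeight α → b'.1.1 ≠ topHeight α → R.filling b < R.filling b'

/-- Ribbon tableaux whose topmost row contains the smallest entries come from standard immaculate
tableaux. -/
theorem SRT.TopFirst.exists_toSRT {R : SRT α.tilde} (h : R.TopFirst) : ∃ T : SIT α, T.toSRT = R := by
  refine ⟨⟨(cellEquiv α).symm.trans R.filling, ?_, ?_⟩, ?_⟩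
  · intro c c' h1 h2
    obtain ⟨b, rfl⟩ := (cellEquiv α).surjective c
    obtain ⟨b', rfl⟩ := (cellEquiv α).surjective c'
    simp only [Equiv.trans_apply, Equiv.symm_apply_apply]
    rw [cellEquiv_val, cellEquiv_val] at h1 h2
    rcases ribbonCells_cases b.2 with ⟨c1, r, hr, c2, c3⟩ | ⟨c1, c2, c3, c4, c5⟩ <;>
      rcases ribbonCells_cases b'.2 with ⟨c1', r', hr', c2', c3'⟩ | ⟨c1', c2', c3', c4', c5'⟩
    · rw [c3, c3'] at h2
      exact absurd h2 (lt_irrefl _)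
    · exact h b b' c1 c1'.ne
    · rw [c3'] at h2
      exact absurd h2 (Nat.not_lt_zero _)
    · rw [c5, c5'] at h1 h2
      simp only at h1 h2
      have hj : b.1.2 = b'.1.2 := by
        rcases lt_trichotomy b.1.2 b'.1.2 with hlt | heq | hlt
        · have := longRow_lt_longRow c2' hlt
          omega
        · exact heq
        · have := longRow_lt_longRow c2 hlt
          omega
      refine R.col_lt b b' hj ?_
      rw [hj] at h2
      omega
  · intro c c' h0 h0' h2
    obtain ⟨b, rfl⟩ := (cellEquiv α).surjective c
    obtain ⟨b', rfl⟩ := (cellEquiv α).surjective c'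
    simp only [Equiv.trans_apply, Equiv.symm_apply_apply]
    rw [cellEquiv_val] at h0 h0'
    rw [cellEquiv_val, cellEquiv_val] at h2
    rcases ribbonCells_cases b.2 with ⟨c1, r, hr, c2, c3⟩ | ⟨c1, c2, c3, c4, c5⟩ <;>
      rcases ribbonCells_cases b'.2 with ⟨c1', r', hr', c2', c3'⟩ | ⟨c1', c2', c3', c4', c5'⟩
    · rw [c3, c3'] at h2
      simp only at h2
      exact R.row_lt b b' (by omega) (by omega)
    · rw [c5'] at h0'
      simp only at h0'
      omega
    · rw [c5] at h0
      simp only at h0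
      omega
    · rw [c5] at h0
      simp only at h0
      omega
  · apply SRT.ext
    ext b
    simp [SIT.toSRT]

theorem mem_range_immaculateHom {v : (ribbonAction α.tilde).Mod}
    (hv : ∀ R, (ribbonAction α.tilde).coeff v R ≠ 0 → R.TopFirst) :
    v ∈ LinearMap.range (immaculateHom α) := by
  refine ⟨(immaculateAction α).coeff.symm
    (((ribbonAction α.tilde).coeff v).comapDomain SIT.toSRT SIT.toSRT_injective.injOn), ?_⟩
  apply (ribbonAction α.tilde).coeff.injective
  ext R
  by_cases hR : ∃ T : SIT α, T.toSRT = R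
  · obtain ⟨T, rfl⟩ := hR
    rw [coeff_immaculateHom_toSRT, LinearEquiv.apply_symm_apply, Finsupp.comapDomain_apply]
  · have h0 : (ribbonAction α.tilde).coeff v R = 0 := by
      by_contra hne
      exact hR (hv R hne).exists_toSRT
    rw [h0]
    exact partialLin_apply_eq_zero _ _ fun T _ h => hR ⟨T, Option.some_injective _ h⟩

end

noncomputable section

/-! ### Eigenvectors in ribbon modules -/

open Filling HeckeAction

variable {n : ℕ}

section

variable {β : GenComposition n}

/-- A common eigenvector (or zero) of all `π_i`; the eigenvalue of an idempotent is `0` or `1`. -/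
def IsHeckeEigenvector (v : (ribbonAction β).Mod) : Prop :=
  ∀ i : Fin (n - 1), (heckePi i : ZeroHecke n) • v = v ∨ (heckePi i : ZeroHecke n) • v = 0

theorem SRT.act_swap {T : SRT β} {i : Fin (n - 1)} (hd : T.IsDescent i) (hr : ¬ T.SameRow i) :
    (ribbonAction β).s i T = some (T.swap i hd hr) := by
  change SRT.act i T = _
  rw [SRT.act, dif_pos hd, dif_neg hr]

theorem SRT.eq_or_eq_swap {i : Fin (n - 1)} {T T' : SRT β}
    (h : (ribbonAction β).s i T = some T') : T = T' ∨ T.filling = T'.filling.swap i := by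
  change SRT.act i T = _ at h
  rw [SRT.act] at h
  split_ifs at h with hd hr
  · right
    rw [← Option.some_injective _ h]
    exact (T.filling.swap_swap i).symm
  · exact Or.inl (Option.some_injective _ h)

theorem SRT.rank_act (i : Fin (n - 1)) (T T' : SRT β) (h : (ribbonAction β).s i T = some T') :
    T' = T ∨ T'.filling.rank < T.filling.rank := by
  change SRT.act i T = _ at h
  rw [SRT.act] at h
  split_ifs at h with hd hr
  · right
    rw [← Option.some_injective _ h]
    exact T.filling.rank_swap_lt i ((T.isDescent_iff i).1 hd)
  · exact Or.inl (Option.some_injective _ h).symm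

theorem Filling.swap_ne_self (F : Filling (genRibbonCells β.summands) n) (i : Fin (n - 1)) :
    F.swap i ≠ F := by
  intro h
  have := F.pos_swap_lo i
  rw [h] at this
  exact lo_ne_hi i (F.pos_injective this)

variable {v : (ribbonAction β).Mod}

/-- The support of an eigenvector is closed under the moves of tableaux. -/
theorem IsHeckeEigenvector.coeff_swap_ne_zero (hv : IsHeckeEigenvector v) {T : SRT β}
    (hT : (ribbonAction β).coeff v T ≠ 0) {i : Fin (n - 1)} (hd : T.IsDescent i)
    (hr : ¬ T.SameRow i) : (ribbonAction β).coeff v (T.swap i hd hr) ≠ 0 := by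
  refine (ribbonAction β).coeff_ne_zero_of_moved (hv i) hT (SRT.act_swap hd hr) ?_ ?_
  · exact fun h => T.filling.swap_ne_self i (congrArg SRT.filling h)
  · intro T' hT'
    rcases SRT.eq_or_eq_swap hT' with h | h
    · exact Or.inr h
    · left
      apply SRT.ext
      rw [h]
      exact T.filling.swap_swap i

theorem IsHeckeEigenvector.smul_eq_zero (hv : IsHeckeEigenvector v) {T : SRT β}
    (hT : (ribbonAction β).coeff v T ≠ 0) {i : Fin (n - 1)} (hd : T.IsDescent i) :
    (heckePi i : ZeroHecke n) • v = 0 := by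
  refine (ribbonAction β).smul_eq_zero_of_moved (hv i) hT ?_
  change SRT.act i T ≠ _
  rw [SRT.act, dif_pos hd]
  split_ifs with hr
  · simp
  · exact fun h => T.filling.swap_ne_self i (congrArg SRT.filling (Option.some_injective _ h))

/-- If `π_i` kills `v`, a tableau in the support of `v` in which `i` is above `i + 1` is obtained
from another tableau in the support by exchanging the two entries. -/
theorem exists_swap_mem_support {i : Fin (n - 1)} (hi : (heckePi i : ZeroHecke n) • v = 0)
    {T : SRT β} (hT : (ribbonAction β).coeff v T ≠ 0) (hd : ¬ T.IsDescent i) :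
    ∃ T' : SRT β, (ribbonAction β).coeff v T' ≠ 0 ∧ T'.filling = T.filling.swap i := by
  have hact : (ribbonAction β).s i T = some T := by
    change SRT.act i T = _
    rw [SRT.act, dif_neg hd]
  by_contra hcon
  push Not at hcon
  apply hT
  rw [← partialLin_apply_of_unique ((ribbonAction β).s i) ((ribbonAction β).coeff v) hact,
    ← coeff_heckePi_smul, hi]
  · simp
  · intro T' hT' h
    exact (SRT.eq_or_eq_swap h).resolve_right (hcon T' hT')

end

variable {α : Composition n} {v : (ribbonAction α.tilde).Mod}

/-- If there are cells below the topmost row, the highest one is below the leftmost cell of the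
topmost row. -/
theorem exists_corner {b : ℕ × ℕ} (hb : b ∈ genRibbonCells α.tilde.summands)
    (h : b.1 ≠ topHeight α) :
    ∃ c ∈ genRibbonCells α.tilde.summands, ∃ d ∈ genRibbonCells α.tilde.summands,
      c.1 = topHeight α ∧ d.1 < c.1 ∧ d.2 = c.2 ∧
      ∀ b ∈ genRibbonCells α.tilde.summands, b.1 ≠ topHeight α → b ≠ d → b.1 < d.1 := by
  have hm : 0 < numLong α ∧ 0 < α.length := by
    rw [mem_ribbonCells] at hb
    rcases hb with hb | hb
    · exact absurd hb.1 h
    · exact ⟨(Nat.zero_le _).trans_lt hb.1, (Nat.zero_le _).trans_lt (longRow_lt hb.1)⟩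
  have h1 := base_lt (α := α) (show numLong α - 1 < numLong α by omega)
  have h2 : base α (numLong α - 1 + 1) = topHeight α := by
    rw [topHeight]
    congr 1
    omega
  refine ⟨(topHeight α, numLong α - 1), ?_, (topHeight α - 1, numLong α - 1), ?_, rfl, ?_, rfl,
    ?_⟩
  · rw [mem_ribbonCells]
    exact Or.inl ⟨rfl, le_rfl, by simp only; omega⟩
  · rw [mem_ribbonCells]
    right
    simp only
    omega
  · simp only
    omega
  · intro b hb hbt hbd
    rcases ribbonCells_cases hb with ⟨c1, r, hr, c2, c3⟩ | ⟨c1, c2, c3, c4, c5⟩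
    · exact absurd c1 hbt
    · simp only
      rcases Nat.lt_or_ge b.2 (numLong α - 1) with hlt | hge
      · have := base_mono (α := α) (show b.2 + 1 ≤ numLong α - 1 from hlt)
        omega
      · have e : b.2 = numLong α - 1 := by omega
        have : b.1 ≠ topHeight α - 1 := fun e' => hbd (Prod.ext e' e)
        omega

theorem exists_switch {P : ℕ → Prop} {a b : ℕ} (hab : a ≤ b) (ha : ¬ P a) (hb : P b) :
    ∃ k, a ≤ k ∧ k < b ∧ ¬ P k ∧ P (k + 1) := by
  induction b, hab using Nat.le_induction with
  | base => exact absurd hb ha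
  | succ b hab ih =>
    by_cases h : P b
    · obtain ⟨k, h1, h2, h3⟩ := ih h
      exact ⟨k, h1, by omega, h3⟩
    · exact ⟨b, hab, by omega, h, hb⟩

/-- If not all entries of the topmost row are smaller than the others, there are an entry `i` below
the topmost row and an entry `i + 1` in the topmost row. -/
theorem SRT.exists_of_not_topFirst {T : SRT α.tilde} (h : ¬ T.TopFirst) :
    ∃ i : Fin (n - 1), (T.filling.pos (lo i)).1 ≠ topHeight α ∧
      (T.filling.pos (hi i)).1 = topHeight α := by
  unfold SRT.TopFirst at h
  push Not at h
  obtain ⟨b, b', hb, hb', hle⟩ := h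
  obtain ⟨k, h1, h2, h3, h4⟩ := exists_switch
    (P := fun k => ∃ hk : k < n, (T.filling.pos ⟨k, hk⟩).1 = topHeight α)
    (a := (T.filling b').1) (b := (T.filling b).1) hle
    (by
      rintro ⟨hk, h⟩
      exact hb' ((congrArg Prod.fst (T.filling.pos_apply b')).symm.trans h))
    ⟨(T.filling b).2, (congrArg Prod.fst (T.filling.pos_apply b)).trans hb⟩
  obtain ⟨hk, h4⟩ := h4
  exact ⟨⟨k, by omega⟩, fun h => h3 ⟨by omega, h⟩, h4⟩

theorem SRT.le_topHeight {b : ℕ × ℕ} (hb : b ∈ genRibbonCells α.tilde.summands) :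
    b.1 ≤ topHeight α := by
  rcases ribbonCells_cases hb with ⟨h, _⟩ | ⟨h, _⟩
  · exact h.le
  · exact h.le

/-- If `π_i` kills an eigenvector, it has no tableau in its support with the entries `≤ i` in the
topmost row and the entry `i + 1` right below the leftmost cell of the topmost row. By cancellation,
the support would also contain the tableau in which `i` and `i + 1` are exchanged, and then `π_{i-1}`
kills the eigenvector, too. Going on in this way, the smallest entry would come to lie below the
leftmost cell of the topmost row. -/
theorem not_kill_of_corner (hv : IsHeckeEigenvector v) {c d : ℕ × ℕ}
    (hc : c ∈ genRibbonCells α.tilde.summands) (hd : d ∈ genRibbonCells α.tilde.summands)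
    (hct : c.1 = topHeight α) (hdc : d.1 < c.1) (hcol : d.2 = c.2)
    (k : ℕ) (hk : k < n - 1) (T : SRT α.tilde) (hT : (ribbonAction α.tilde).coeff v T ≠ 0)
    (htop : ∀ j : Fin n, j.1 ≤ k → (T.filling.pos j).1 = topHeight α)
    (hTd : T.filling.pos (hi ⟨k, hk⟩) = d) :
    (heckePi ⟨k, hk⟩ : ZeroHecke n) • v ≠ 0 := by
  intro hkill
  induction k generalizing T with
  | zero =>
    have h0 := htop (lo ⟨0, hk⟩) le_rfl
    have hnd : ¬ T.IsDescent ⟨0, hk⟩ := by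
      unfold SRT.IsDescent
      rw [hTd]
      omega
    -- exchanging the two smallest entries, in the same column, does not give a standard tableau
    obtain ⟨T', hT', hTT'⟩ := exists_swap_mem_support hkill hT hnd
    have hlt := T'.col_lt ⟨c, hc⟩ ⟨d, hd⟩ hcol.symm hdc
    have hpd : T'.filling.pos (lo ⟨0, hk⟩) = d := by rw [hTT', Filling.pos_swap_lo, hTd]
    have hd0 : T'.filling ⟨d, hd⟩ = lo ⟨0, hk⟩ := by
      rw [← T'.filling.apply_pos (lo ⟨0, hk⟩) (T'.filling.pos_mem _)]
      exact congrArg _ (Subtype.ext hpd.symm)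
    rw [hd0] at hlt
    exact absurd hlt (Nat.not_lt_zero _)
  | succ k ih =>
    have h0 := htop (lo ⟨k + 1, hk⟩) le_rfl
    have hnd : ¬ T.IsDescent ⟨k + 1, hk⟩ := by
      unfold SRT.IsDescent
      rw [hTd]
      omega
    obtain ⟨T', hT', hTT'⟩ := exists_swap_mem_support hkill hT hnd
    have e : hi ⟨k, by omega⟩ = lo (⟨k + 1, hk⟩ : Fin (n - 1)) := rfl
    -- `k` and `k + 1` are both in the topmost row of `T`
    have hkill' : (heckePi ⟨k, by omega⟩ : ZeroHecke n) • v = 0 := by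
      refine hv.smul_eq_zero hT (i := ⟨k, by omega⟩) ?_
      unfold SRT.IsDescent
      rw [htop _ (by simp [lo]), htop _ (by simp [hi])]
    refine ih (by omega) T' hT' ?_ ?_ hkill'
    · intro j hj
      rw [hTT', Filling.pos_swap, Equiv.swap_apply_of_ne_of_ne]
      · exact htop j (by omega)
      · simp only [lo, ne_eq, Fin.ext_iff]
        omega
      · simp only [hi, ne_eq, Fin.ext_iff]
        omega
    · rw [hTT', e, Filling.pos_swap_lo, hTd]

/-- In all tableaux in the support of an eigenvector, the topmost row contains the smallest
entries. -/
theorem IsHeckeEigenvector.topFirst (hv : IsHeckeEigenvector v) {T : SRT α.tilde}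
    (hT : (ribbonAction α.tilde).coeff v T ≠ 0) : T.TopFirst := by
  by_contra hnot
  have hlow : ∀ {T : SRT α.tilde} {i : Fin (n - 1)}, (T.filling.pos (lo i)).1 ≠ topHeight α →
      (T.filling.pos (hi i)).1 = topHeight α → T.IsDescent i ∧ ¬ T.SameRow i := by
    intro T i h1 h2
    have := SRT.le_topHeight (T.filling.pos_mem (lo i))
    unfold SRT.IsDescent SRT.SameRow
    omega
  obtain ⟨T, ⟨hT, hnot⟩, hmin⟩ := (measure fun T : SRT α.tilde => T.filling.rank).wf.has_min
    {T | (ribbonAction α.tilde).coeff v T ≠ 0 ∧ ¬ T.TopFirst} ⟨T, hT, hnot⟩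
  -- by minimality of the rank, one further move brings the smallest entries into the topmost row
  obtain ⟨i, hi1, hi2⟩ := SRT.exists_of_not_topFirst hnot
  obtain ⟨hdes, hrow⟩ := hlow hi1 hi2
  have hkill := hv.smul_eq_zero hT hdes
  have hS := hv.coeff_swap_ne_zero hT hdes hrow
  have hSfirst : (T.swap i hdes hrow).TopFirst := by
    by_contra h
    exact hmin (T.swap i hdes hrow) ⟨hS, h⟩
      (T.filling.rank_swap_lt i ((T.isDescent_iff i).1 hdes))
  have hSlo : ((T.swap i hdes hrow).filling.pos (lo i)).1 = topHeight α := by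
    rw [show (T.swap i hdes hrow).filling = T.filling.swap i from rfl, Filling.pos_swap_lo, hi2]
  have hShi : ((T.swap i hdes hrow).filling.pos (hi i)).1 ≠ topHeight α := by
    rw [show (T.swap i hdes hrow).filling = T.filling.swap i from rfl, Filling.pos_swap_hi]
    exact hi1
  obtain ⟨c, hc, d, hd, hct, hdc, hcol, hhigh⟩ := exists_corner (T.filling.pos_mem (lo i)) hi1
  -- among the tableaux with the entries `≤ i` in the topmost row, make the entry of `d` minimal
  let good : Set (SRT α.tilde) := {R | (ribbonAction α.tilde).coeff v R ≠ 0 ∧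
    ∀ j : Fin n, (R.filling.pos j).1 = topHeight α ↔ j.1 ≤ i.1}
  have hgood : (T.swap i hdes hrow) ∈ good := by
    refine ⟨hS, fun j => ?_⟩
    constructor
    · intro hj
      have := hSfirst ⟨_, (T.swap i hdes hrow).filling.pos_mem j⟩
        ⟨_, (T.swap i hdes hrow).filling.pos_mem (hi i)⟩ hj hShi
      rw [Filling.apply_pos, Filling.apply_pos] at this
      simp only [hi, Fin.lt_def] at this
      omega
    · intro hj
      by_contra hne
      have := hSfirst ⟨_, (T.swap i hdes hrow).filling.pos_mem (lo i)⟩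
        ⟨_, (T.swap i hdes hrow).filling.pos_mem j⟩ hSlo hne
      rw [Filling.apply_pos, Filling.apply_pos] at this
      simp only [lo, Fin.lt_def] at this
      omega
  obtain ⟨R, hR, hRmin⟩ := (measure fun R : SRT α.tilde => (R.filling ⟨d, hd⟩).1).wf.has_min
    good ⟨_, hgood⟩
  have hRd : R.filling.pos (R.filling ⟨d, hd⟩) = d := Filling.pos_apply _ _
  have hdi : i.1 < (R.filling ⟨d, hd⟩).1 := by
    by_contra hle
    have := (hR.2 (R.filling ⟨d, hd⟩)).2 (by omega)
    rw [hRd] at this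
    omega
  have hdeq : (R.filling ⟨d, hd⟩).1 = i.1 + 1 := by
    by_contra hne
    obtain ⟨k, hk⟩ : ∃ k, (R.filling ⟨d, hd⟩).1 = k + 1 := ⟨(R.filling ⟨d, hd⟩).1 - 1, by omega⟩
    have hkn := (R.filling ⟨d, hd⟩).2
    let j : Fin (n - 1) := ⟨k, by omega⟩
    have hj : hi j = R.filling ⟨d, hd⟩ := Fin.ext hk.symm
    have hlo : (R.filling.pos (lo j)).1 ≠ topHeight α := by
      intro h
      have := (hR.2 (lo j)).1 h
      simp only [lo, j] at this
      omega
    have hlt : (R.filling.pos (lo j)).1 < d.1 := by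
      refine hhigh _ (R.filling.pos_mem _) hlo fun h => ?_
      rw [← hRd, ← hj] at h
      exact lo_ne_hi j (R.filling.pos_injective h)
    have hpd : R.filling.pos (hi j) = d := by rw [hj, hRd]
    have hdes' : R.IsDescent j := by
      unfold SRT.IsDescent
      rw [hpd]
      exact hlt.le
    have hrow' : ¬ R.SameRow j := by
      unfold SRT.SameRow
      rw [hpd]
      exact hlt.ne
    refine hRmin (R.swap j hdes' hrow') ⟨hv.coeff_swap_ne_zero hR.1 hdes' hrow', fun l => ?_⟩ ?_
    · change ((R.filling.swap j).pos l).1 = _ ↔ _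
      rw [Filling.pos_swap, hR.2]
      by_cases h1 : l = lo j
      · rw [h1, Equiv.swap_apply_left]
        simp only [lo, hi, j]
        omega
      by_cases h2 : l = hi j
      · rw [h2, Equiv.swap_apply_right]
        simp only [lo, hi, j]
        omega
      rw [Equiv.swap_apply_of_ne_of_ne h1 h2]
    · change (Equiv.swap (lo j) (hi j) (R.filling ⟨d, hd⟩)).1 < (R.filling ⟨d, hd⟩).1
      rw [← hj, Equiv.swap_apply_right]
      exact lo_lt_hi j
  refine not_kill_of_corner hv hc hd hct hdc hcol i.1 i.2 R hR.1
    (fun j hj => (hR.2 j).2 hj) ?_ hkill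
  have : hi i = R.filling ⟨d, hd⟩ := Fin.ext hdeq.symm
  change R.filling.pos (hi i) = d
  rw [this, hRd]

/-- Every nonzero submodule of the ribbon module meets the image of `V_α`. -/
theorem immaculateHom_essential (W : Submodule (ZeroHecke n) (ribbonAction α.tilde).Mod)
    (hW : W ≠ ⊥) : W ⊓ LinearMap.range (immaculateHom α) ≠ ⊥ := by
  obtain ⟨v, hvW, hv0, hv⟩ := (ribbonAction α.tilde).exists_eigenvector
    (fun T => T.filling.rank) SRT.rank_act W hW
  rw [Submodule.ne_bot_iff]
  exact ⟨v, ⟨hvW, mem_range_immaculateHom fun T hT =>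
    IsHeckeEigenvector.topFirst (v := v) hv hT⟩, hv0⟩

/-- The socle lies in every essential submodule. -/
theorem moduleSocle_le_of_essential {R M : Type} [Ring R] [AddCommGroup M] [Module R M]
    {N : Submodule R M} (h : ∀ X : Submodule R M, X ≠ ⊥ → X ⊓ N ≠ ⊥) : moduleSocle R M ≤ N := by
  refine sSup_le fun S hS => ?_
  have hat : IsAtom S := isSimpleModule_iff_isAtom.1 hS
  exact inf_eq_left.1 ((hat.le_iff.1 inf_le_left).resolve_left (h S hat.1))

end

theorem theorem4p1 (n : ℕ) (α : Composition n) :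
    (∀ T : SIT α, ∃! R : SRT α.tilde, IsRibbonTableauOf T R) ∧
    ∃ ι : ImmaculateModule α →ₗ[ZeroHecke n] RibbonModule α.tilde,
      (∀ (T : SIT α) (R : SRT α.tilde), IsRibbonTableauOf T R →
        ι (ImmaculateModule.of T) = RibbonModule.of R) ∧
      IsInjectiveHull ι ∧
      moduleSocle (ZeroHecke n) (RibbonModule α.tilde) ≤ LinearMap.range ι := by
  refine ⟨fun T => ⟨T.toSRT, T.isRibbonTableauOf_toSRT, fun R hR => isRibbonTableauOf_iff.1 hR⟩,
    immaculateHom α, ?_, ⟨immaculateHom_injective, injective_ribbonModule α.tilde,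
      immaculateHom_essential⟩, moduleSocle_le_of_essential immaculateHom_essential⟩
  intro T R hR
  rw [isRibbonTableauOf_iff.1 hR]
  exact partialLin_single (fun T : SIT α => some T.toSRT) T
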